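/- Let $X$ be a finite regular CW complex, i.e. a finite (Hausdorff) CW complex each of whose attaching maps is a homeomorphism onto its image. For cells write $x>y$ if the closed cell $y$ is strictly contained in the closed cell $x$. Let $f$ be a discrete Morse function on $X$: a real function on the cells such that for each $k$-cell $x$ there is at most one $(k+1)$-cell $y\supseteq x$ with $f(x)\ge f(y)$ and at most one $(k-1)$-cell $y\subseteq x$ with $f(y)\ge f(x)$. A regular pair is a pair of a $k$-cell $x$ and a $(k+1)$-cell $y\supseteq x$ with $f(x)\ge f(y)$; a cell is critical if it lies in no regular pair. The entrance path category $\mathrm{Ent}[X]$ has the cells as objects; its morphisms $x\to y$ are the strictly descending sequences $x=x_0>x_1>\dots>x_k=y$, composed by concatenation and ordered by $p\Rightarrow q$ if $p$ is a (not necessarily contiguous) subsequence of $q$. Put $r(x_0>\dots>x_k)=k$. Let $\Sigma$ be the set of morphisms $(y>x)$ for the regular pairs $\{x,y\}$, and $\Sigma^+$ its union with all identities. Let $w,z$ be critical cells. A zigzag from $w$ to $z$ is a diagram in $\mathrm{Ent}[X]$ $$\tau=\left(w=x_0\xrightarrow{g_0}y_0\xleftarrow{f_0}x_1\xrightarrow{g_1}\cdots\xleftarrow{f_{k-1}}x_k\xrightarrow{g_k}y_k=z\right),\qquad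 k\ge 0,\ f_i\in\Sigma^+ .$$ Let $\mathrm{Hom}(w,z)$ be the set of zigzags modulo the equivalence relation generated by (H) replacing $x_i\xrightarrow{g_i}y_i\xleftarrow{\mathrm{id}}y_i\xrightarrow{g_{i+1}}y_{i+1}$ by $x_i\xrightarrow{g_{i+1}\circ g_i}y_{i+1}$, and (V) relating two zigzags of the same length (unprimed and primed) if there are $u_i\colon y_i\to y_i'$ and $v_i\colon x_i\to x_i'$ in $\Sigma^+$ with $v_0=\mathrm{id}_w$, $u_k=\mathrm{id}_z$, $g_i'\circ v_i=u_i\circ g_i$ and $f_i'\circ v_{i+1}=u_i\circ f_i$. For $\gamma,\gamma'\in\mathrm{Hom}(w,z)$ let $\gamma'\Rightarrow\gamma$ if there are representatives $\tau$ of $\gamma$ and $\tau'$ of $\gamma'$ of the same length and maps $u_i,v_i$ as in (V), except that the equalities are weakened to $g_i'\circ v_i\Rightarrow u_i\circ g_i$ and $f_i'\circ v_{i+1}\Rightarrow u_i\circ f_i$. (This is the Hom set, with its order, of the discrete flow category of $f$.) **Theorem.** The relation $\Rightarrow$ is a partial order on $\mathrm{Hom}(w,z)$. Let $P_{w,z}=\mathrm{Hom}(w,z)^{\mathrm{op}}\cup\{\hat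 0\}$ be the opposite poset with a new least element $\hat 0$ adjoined. For a zigzag $\tau$ as above, the integer $$\dim w-\dim z+\sum_{i=0}^{k-1}r(f_i)-\sum_{i=0}^{k}r(g_i)$$ depends only on the class $[\tau]$. Hence there is a function $\rho\colon P_{w,z}\to\mathbb Z$ with $\rho(\hat 0)=-1$ and with $\rho([\tau])$ equal to this integer for all $\tau$, and $\rho$ is a rank function: $\rho(x)>\rho(y)$ whenever $x>y$ in $P_{w,z}$, and $\rho(x)=\rho(y)+1$ whenever $x$ covers $y$. Thus $P_{w,z}$ is a graded poset. -/

import Mathlib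

namespace DiscreteFlow

open Topology

section CellComplex

variable {X : Type*} [TopologicalSpace X] (C : Set X) [CWComplex C]

/-- A CW complex is regular if each attaching map (the characteristic map restricted to the
boundary sphere) is a homeomorphism onto its image. -/
def IsRegularCW : Prop :=
  ∀ (n : ℕ) (i : RelCWComplex.cell C n),
    IsEmbedding ((Metric.sphere (0 : Fin n → ℝ) 1).domRestrict (RelCWComplex.map n i))

/-- The cells of the complex, of all dimensions. -/
abbrev Cell := Σ n : ℕ, RelCWComplex.cell C n

end CellComplex

section Flow

variable {X : Type*} [TopologicalSpace X] {C : Set X} [CWComplex C]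

/-- The dimension of a cell. -/
def Cell.dim (x : Cell C) : ℕ := x.1

/-- The closed cell, as a subset of the ambient space. -/
def Cell.carrier (x : Cell C) : Set X := RelCWComplex.closedCell x.1 x.2

/-- `Cell.Above x y` is the relation `x > y`: the cell `y` is strictly contained in `x`. -/
def Cell.Above (x y : Cell C) : Prop := y.carrier ⊂ x.carrier

/-- `{x, y}` is a regular pair of `f`: `x` is a `k`-cell, `y` is a `(k+1)`-cell, `x ⊆ y` and
`f x ≥ f y`. -/
def IsRegularPair (f : Cell C → ℝ) (x y : Cell C) : Prop :=
  y.dim = x.dim + 1 ∧ x.carrier ⊆ y.carrier ∧ f x ≥ f y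

/-- Discrete Morse functions: for each cell `x` there is at most one `y` of one dimension more with
`x ⊆ y` and `f x ≥ f y`, and at most one `y` of one dimension less with `y ⊆ x` and
`f y ≥ f x`. -/
structure IsDiscreteMorse (f : Cell C → ℝ) : Prop where
  up : ∀ x : Cell C, {y | IsRegularPair f x y}.Subsingleton
  down : ∀ x : Cell C, {y | IsRegularPair f y x}.Subsingleton

/-- Critical cells of `f`; these are the objects of the discrete flow category. -/
def IsCritical (f : Cell C → ℝ) (x : Cell C) : Prop :=
  (∀ y, ¬ IsRegularPair f x y) ∧ ∀ y, ¬ IsRegularPair f y x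

/-- Morphisms `x → y` of the entrance path category: strictly descending sequences of cells
`x = x₀ > x₁ > ⋯ > xₖ = y`. -/
inductive Ent : Cell C → Cell C → Type _
  | id (x : Cell C) : Ent x x
  | cons {x y z : Cell C} (h : x.Above y) (p : Ent y z) : Ent x z

/-- The underlying sequence of cells `[x₀, x₁, …, xₖ]`. -/
def Ent.cells : {x y : Cell C} → Ent x y → List (Cell C)
  | _, _, .id x => [x]
  | x, _, .cons _ p => x :: p.cells

/-- The number `r` of steps: `r (x₀ > x₁ > ⋯ > xₖ) = k`. -/
def Ent.r : {x y : Cell C} → Ent x y → ℕ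
  | _, _, .id _ => 0
  | _, _, .cons _ p => p.r + 1

/-- Composition by concatenation, in diagrammatic order: `p.comp q` is first `p`, then `q`. -/
def Ent.comp : {x y z : Cell C} → Ent x y → Ent y z → Ent x z
  | _, _, _, .id _, q => q
  | _, _, _, .cons h p, q => .cons h (p.comp q)

/-- The partial order `p ⇒ q` on parallel entrance paths: `p` is a (not necessarily contiguous)
subsequence of `q`. -/
def Ent.Refines {x y : Cell C} (p q : Ent x y) : Prop := p.cells.Sublist q.cells

/-- The Morse system `Σ` of `f`: the morphisms `(y > x)` for the regular pairs `{x, y}`. -/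
inductive MorseSystem (f : Cell C → ℝ) : {x y : Cell C} → Ent x y → Prop
  | pair {x y : Cell C} (h : y.Above x) (hp : IsRegularPair f x y) :
      MorseSystem f (Ent.cons h (Ent.id x))

/-- The collection `Σ⁺`, the union of `Σ` with all identities. -/
inductive SigmaPlus (f : Cell C → ℝ) : {x y : Cell C} → Ent x y → Prop
  | id (x : Cell C) : SigmaPlus f (Ent.id x)
  | mem {x y : Cell C} {p : Ent x y} (h : MorseSystem f p) : SigmaPlus f p

/-- Zigzags `x₀ -g₀→ y₀ ←f₀- x₁ -g₁→ ⋯ ←fₖ₋₁- xₖ -gₖ→ yₖ = z` with all `fᵢ` in `Σ⁺`, from the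
varying starting point `x₀` to the fixed end point `z`. -/
inductive Zigzag (f : Cell C → ℝ) (z : Cell C) : Cell C → Type _
  | last {x : Cell C} (g : Ent x z) : Zigzag f z x
  | step {x y x' : Cell C} (g : Ent x y) (b : Ent x' y) (hb : SigmaPlus f b)
      (t : Zigzag f z x') : Zigzag f z x

namespace Zigzag

variable {f : Cell C → ℝ} {z : Cell C}

/-- The sum of `r (gᵢ)` over the forward morphisms. -/
def forward : {x : Cell C} → Zigzag f z x → ℕ
  | _, last g => g.r
  | _, step g _ _ t => g.r + t.forward

/-- The sum of `r (fᵢ)` over the backward morphisms. -/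
def backward : {x : Cell C} → Zigzag f z x → ℕ
  | _, last _ => 0
  | _, step _ b _ t => b.r + t.backward

/-- The value `dim w - dim z + ∑ r (fᵢ) - ∑ r (gᵢ)` of a zigzag from `w` to `z`. -/
def rank {w : Cell C} (τ : Zigzag f z w) : ℤ :=
  (w.dim : ℤ) - (z.dim : ℤ) + (τ.backward : ℤ) - (τ.forward : ℤ)

/-- Precompose the first forward morphism of a zigzag with `g`. -/
def precomp {x y : Cell C} (g : Ent x y) : Zigzag f z y → Zigzag f z x
  | last g' => last (g.comp g')
  | step g' b hb t => step (g.comp g') b hb t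

/-- Removal of one intermediate identity map:
`x -g→ y ←id- y -g'→ ⋯` becomes `x -g' ∘ g→ ⋯`. -/
inductive Horizontal : {x : Cell C} → Zigzag f z x → Zigzag f z x → Prop
  | remove {x y : Cell C} (g : Ent x y) (h : SigmaPlus f (Ent.id y)) (t : Zigzag f z y) :
      Horizontal (step g (Ent.id y) h t) (t.precomp g)
  | inside {x y x' : Cell C} (g : Ent x y) (b : Ent x' y) (hb : SigmaPlus f b)
      {t t' : Zigzag f z x'} (h : Horizontal t t') : Horizontal (step g b hb t) (step g b hb t')

/-- `Ladder R v τ τ'`: the zigzags `τ` (top row) and `τ'` (bottom row) are the rows of a diagram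
with leftmost vertical map `v`, all other vertical maps `uᵢ : yᵢ → yᵢ'` and `vᵢ : xᵢ → xᵢ'` in
`Σ⁺`, and the identity of `z` as rightmost vertical map. In each square, the composite
through the bottom row is required to be in relation `R` with the composite through the top row. -/
inductive Ladder (R : ∀ a b : Cell C, Ent a b → Ent a b → Prop) :
    {x x' : Cell C} → Ent x x' → Zigzag f z x → Zigzag f z x' → Prop
  | last {x x' : Cell C} (v : Ent x x') (g : Ent x z) (g' : Ent x' z)
      (hg : R _ _ (v.comp g') (g.comp (Ent.id z))) : Ladder R v (last g) (last g')
  | step {x x' y y' x₁ x₁' : Cell C} (v : Ent x x') (u : Ent y y') (v₁ : Ent x₁ x₁')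
      (hu : SigmaPlus f u) (hv₁ : SigmaPlus f v₁)
      (g : Ent x y) (g' : Ent x' y') (hg : R _ _ (v.comp g') (g.comp u))
      (b : Ent x₁ y) (b' : Ent x₁' y') (hb : SigmaPlus f b) (hb' : SigmaPlus f b')
      (hbb : R _ _ (v₁.comp b') (b.comp u))
      {t : Zigzag f z x₁} {t' : Zigzag f z x₁'} (ht : Ladder R v₁ t t') :
      Ladder R v (step g b hb t) (step g' b' hb' t')

/-- Zigzags that form the rows of a commutative diagram. -/
def Vertical {x : Cell C} (τ τ' : Zigzag f z x) : Prop :=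
  Ladder (fun _ _ p q => p = q) (Ent.id x) τ τ'

/-- The equivalence relation generated by horizontal and vertical relations. -/
def setoid (f : Cell C → ℝ) (w z : Cell C) : Setoid (Zigzag f z w) :=
  Relation.EqvGen.setoid fun τ τ' => Horizontal τ τ' ∨ Vertical τ τ'

end Zigzag

/-- The morphisms `w → z` of the localization of the entrance path category at `Σ`. For critical
`w` and `z` these are the morphisms of the discrete flow category, a full subcategory. -/
def FlowHom (f : Cell C → ℝ) (w z : Cell C) : Type _ := Quotient (Zigzag.setoid f w z)

/-- The class of a zigzag. -/
def FlowHom.mk {f : Cell C → ℝ} {w z : Cell C} (τ : Zigzag f z w) : FlowHom f w z :=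
  Quotient.mk (Zigzag.setoid f w z) τ

/-- The relation `γ' ⇒ γ`: some representatives of `γ` and `γ'` are the top and the bottom row of a
diagram in which every square satisfies `(through the bottom row) ⇒ (through the top row)`. -/
def FlowHom.Implies {f : Cell C → ℝ} {w z : Cell C} (γ' γ : FlowHom f w z) : Prop :=
  ∃ τ τ' : Zigzag f z w, FlowHom.mk τ = γ ∧ FlowHom.mk τ' = γ' ∧
    Zigzag.Ladder (fun _ _ p q => p.Refines q) (Ent.id w) τ τ'

end Flow

/-- A rank function on a poset: it is strictly monotone and increases by one along covering
relations. -/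
structure IsRankFunction {P : Type*} [PartialOrder P] (ρ : P → ℤ) : Prop where
  strict : ∀ x y : P, y < x → ρ y < ρ x
  cover : ∀ x y : P, y ⋖ x → ρ x = ρ y + 1

end DiscreteFlow

/-! An entrance path `p : x → y` satisfies `r p ≤ dim x - dim y`, with equality when `p` lies in Σ⁺.
Dimensions therefore telescope along a zigzag, and the integer of the theorem is the sum of the
defects `dim xᵢ - dim yᵢ - r gᵢ`, in particular nonnegative. It is invariant because `r` is additive
under concatenation: this settles (H) at once, and (V) by comparing the two sides of each commuting
square.

The equality also shows that members of Σ⁺ have no proper refinement. Moreover a refinement of a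
concatenation splits into refinements of the factors (`Ent.Sub.split`). So termwise refinement of
the forward arrows can be transported through (H) and (V) (`exists_finer_equiv`), and a weak ladder
commutes after its bottom row is refined (`exists_finer_commLadder`). The outcome is
`implies_mk_iff`: for any chosen representative `τ` of `γ'`, one has `γ' ⇒ γ` iff `γ` is represented
by a termwise refinement of `τ`. Each inserted cell lowers the rank by one, and cells can be
inserted one at a time; this gives the order axioms and the covers inside Hom.

For covers of the new least element, positive rank must imply that a further refinement exists. Some
step then drops dimension by at least two, and a regular complex has a cell strictly between
(`Cell.Above.exists_between`). That fact rests on invariance of domain, which is derived from a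
volume-polynomial proof that the ball does not retract to its boundary. -/

namespace DiscreteFlow

open Topology

/-! ### Dimensions of cells and refinement of entrance paths. -/

section Combinatorics

variable {X : Type*} [TopologicalSpace X] {C : Set X} [CWComplex C]

/-! ### Dimensions of cells -/

theorem Cell.Above.trans {x y z : Cell C} (h : x.Above y) (h' : y.Above z) : x.Above z :=
  lt_trans (α := Set X) h' h

theorem Cell.Above.irrefl (x : Cell C) : ¬ x.Above x := fun h => h.ne rfl

theorem Cell.disjoint_openCell {x y : Cell C} (h : x ≠ y) :
    Disjoint (RelCWComplex.openCell x.1 x.2) (RelCWComplex.openCell y.1 y.2) :=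
  RelCWComplex.disjoint_openCell_of_ne h

theorem Cell.exists_mem_openCell_of_mem_cellFrontier {x : Cell C} {p : X}
    (hp : p ∈ RelCWComplex.cellFrontier x.1 x.2) :
    ∃ e : Cell C, e.dim < x.dim ∧ p ∈ RelCWComplex.openCell e.1 e.2 := by
  obtain ⟨I, hI⟩ := CWComplex.cellFrontier_subset_finite_openCell x.1 x.2
  have := hI hp
  simp only [Set.mem_iUnion] at this
  obtain ⟨m, hm, j, -, hj⟩ := this
  exact ⟨⟨m, j⟩, hm, hj⟩

/-- The frontier of `x` is covered by open cells of lower dimension, and distinct open cells are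
disjoint. -/
theorem Cell.eq_or_dim_lt_of_openCell_inter {x y : Cell C}
    (h : (RelCWComplex.openCell y.1 y.2 ∩ x.carrier).Nonempty) : y = x ∨ y.dim < x.dim := by
  obtain ⟨p, hp, hpx⟩ := h
  rw [Cell.carrier, ← RelCWComplex.cellFrontier_union_openCell_eq_closedCell] at hpx
  rcases hpx with hpx | hpx
  · obtain ⟨e, he, hpe⟩ := Cell.exists_mem_openCell_of_mem_cellFrontier hpx
    by_cases hye : y = e
    · exact .inr (hye ▸ he)
    · exact (Set.disjoint_left.1 (Cell.disjoint_openCell hye) hp hpe).elim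
  · by_cases hyx : y = x
    · exact .inl hyx
    · exact (Set.disjoint_left.1 (Cell.disjoint_openCell hyx) hp hpx).elim

theorem Cell.Above.dim_lt {x y : Cell C} (h : x.Above y) : y.dim < x.dim := by
  obtain ⟨p, hp⟩ := RelCWComplex.openCell_nonempty y.1 y.2
  refine (Cell.eq_or_dim_lt_of_openCell_inter
    ⟨p, hp, h.subset (RelCWComplex.openCell_subset_closedCell _ _ hp)⟩).resolve_left ?_
  rintro rfl
  exact Cell.Above.irrefl _ h

/-! ### Refinement of entrance paths -/

namespace Ent

@[simp] theorem comp_id {x y : Cell C} (p : Ent x y) : p.comp (id y) = p := by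
  induction p with
  | id => rfl
  | cons h p ih => simp [comp, ih]

@[simp] theorem r_comp {x y z : Cell C} (p : Ent x y) (q : Ent y z) :
    (p.comp q).r = p.r + q.r := by
  induction p with
  | id => simp [comp, r]
  | cons h p ih => simp [comp, r, ih]; omega

theorem eq_or_above {x y : Cell C} (p : Ent x y) : x = y ∨ x.Above y := by
  induction p with
  | id => exact .inl rfl
  | cons h p ih =>
    rcases ih with rfl | ih
    · exact .inr h
    · exact .inr (h.trans ih)

theorem r_add_dim_le {x y : Cell C} (p : Ent x y) : p.r + y.dim ≤ x.dim := by
  induction p with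
  | id => simp [r]
  | cons h p ih => have := h.dim_lt; simp only [r]; omega

theorem above_of_cons {x y z : Cell C} (h : x.Above y) (p : Ent y z) : x.Above z := by
  rcases p.eq_or_above with rfl | h'
  exacts [h, h.trans h']

theorem eq_id {x : Cell C} (p : Ent x x) : p = id x := by
  cases p with
  | id => rfl
  | cons h p => exact (Cell.Above.irrefl x (above_of_cons h p)).elim

theorem head?_cells {x y : Cell C} (p : Ent x y) : p.cells.head? = some x := by
  cases p <;> rfl

theorem head_mem_cells {x y : Cell C} (p : Ent x y) : x ∈ p.cells := by
  cases p <;> simp [cells]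

theorem eq_or_above_of_mem_cells {x y c : Cell C} (p : Ent x y) (hc : c ∈ p.cells) :
    x = c ∨ x.Above c := by
  induction p with
  | id => simp_all [cells]
  | cons h p ih =>
    rcases List.mem_cons.1 hc with rfl | hc
    · exact .inl rfl
    · rcases ih hc with rfl | h'
      exacts [.inr h, .inr (h.trans h')]

/-- Inductive form of the relation `Ent.Refines`. -/
inductive Sub : {x y : Cell C} → Ent x y → Ent x y → Prop
  | id (x : Cell C) : Sub (Ent.id x) (Ent.id x)
  | cons {x y z : Cell C} (h : x.Above y) {p q : Ent y z} (hpq : Sub p q) :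
      Sub (Ent.cons h p) (Ent.cons h q)
  | skip {x y y' z : Cell C} (h : x.Above y) (h' : y.Above y') (h'' : x.Above y')
      {p : Ent y' z} {q : Ent y z} (hpq : Sub (Ent.cons h' p) q) :
      Sub (Ent.cons h'' p) (Ent.cons h q)

namespace Sub

theorem refl {x y : Cell C} (p : Ent x y) : Sub p p := by
  induction p with
  | id x => exact .id x
  | cons h p ih => exact .cons h ih

theorem refines {x y : Cell C} {p q : Ent x y} (h : Sub p q) : p.Refines q := by
  induction h with
  | id x => exact List.Sublist.refl _
  | cons h hpq ih => exact List.Sublist.cons_cons _ ih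
  | skip h h' h'' hpq ih =>
    simp only [Refines, cells] at ih ⊢
    exact ((List.sublist_cons_self _ _).trans ih).cons_cons _

/-- The second cell of `p` occurs in the tail of `q`. It is either the second cell of `q` or
strictly below it, which decides between `cons` and `skip`. -/
theorem of_refines {x y : Cell C} {p q : Ent x y} (h : p.Refines q) : Sub p q := by
  induction q with
  | id x => rw [p.eq_id]; exact .id x
  | @cons x y z hxy q ih =>
    cases p with
    | id => exact (Cell.Above.irrefl _ (above_of_cons hxy q)).elim
    | @cons _ y' _ hxy' p =>
      have h : p.cells.Sublist q.cells := List.Sublist.of_cons_cons h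
      rcases q.eq_or_above_of_mem_cells (h.subset p.head_mem_cells) with rfl | hyy'
      · exact .cons hxy (ih h)
      · refine .skip hxy hyy' hxy' (ih ?_)
        cases q with
        | id => exact (Cell.Above.irrefl _ (above_of_cons hyy' p)).elim
        | cons hq q =>
          refine List.Sublist.cons_cons _ ((List.sublist_cons_iff.1 h).resolve_right ?_)
          rintro ⟨l, hl, -⟩
          have := p.head?_cells
          rw [hl, List.head?_cons, Option.some.injEq] at this
          exact Cell.Above.irrefl _ (this ▸ hyy')

theorem trans {x y : Cell C} {p q s : Ent x y} (h : Sub p q) (h' : Sub q s) : Sub p s :=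
  of_refines (List.Sublist.trans h.refines h'.refines)

theorem r_le {x y : Cell C} {p q : Ent x y} (h : Sub p q) : p.r ≤ q.r := by
  induction h with
  | id => rfl
  | cons h hpq ih => simpa [r] using ih
  | skip h h' h'' hpq ih => simp only [r] at ih ⊢; omega

theorem eq_of_r_le {x y : Cell C} {p q : Ent x y} (h : Sub p q) (hr : q.r ≤ p.r) : p = q := by
  induction h with
  | id => rfl
  | cons h hpq ih => rw [ih (by simpa [r] using hr)]
  | skip h h' h'' hpq ih => have := hpq.r_le; simp only [r] at this hr; omega

/-- A single missing cell is reinserted; these are the unit steps of the rank. -/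
theorem exists_succ {x y : Cell C} {p q : Ent x y} (h : Sub p q) (hr : p.r < q.r) :
    ∃ m, Sub p m ∧ Sub m q ∧ m.r = p.r + 1 := by
  induction h with
  | id => simp at hr
  | cons h hpq ih =>
    obtain ⟨m, hm, hm', hmr⟩ := ih (by simpa [r] using hr)
    exact ⟨_, .cons h hm, .cons h hm', by simp [r, hmr]⟩
  | skip h h' h'' hpq ih => exact ⟨_, .skip h h' h'' (.refl _), .cons h hpq, by simp [r]⟩

theorem comp {x y z : Cell C} {p p' : Ent x y} {q q' : Ent y z} (h : Sub p p') (h' : Sub q q') :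
    Sub (p.comp q) (p'.comp q') := by
  induction h with
  | id => exact h'
  | cons h hpq ih => exact .cons h (ih h')
  | skip h h₁ h₂ hpq ih => exact .skip h h₁ h₂ (ih h')

/-- The cell `y` where the two factors meet survives in every refinement, so `q` can be cut there.
-/
theorem split {x y z : Cell C} {g : Ent x y} {g₁ : Ent y z} {q : Ent x z}
    (h : Sub (g.comp g₁) q) : ∃ (g' : Ent x y) (g₁' : Ent y z),
      q = g'.comp g₁' ∧ Sub g g' ∧ Sub g₁ g₁' := by
  induction q generalizing y with
  | id x =>
    obtain h' | h' := g₁.eq_or_above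
    · subst h'
      exact ⟨g, g₁, by rw [g.eq_id, g₁.eq_id]; rfl, .refl _, .refl _⟩
    · exfalso
      rcases g.eq_or_above with rfl | h''
      exacts [Cell.Above.irrefl _ h', Cell.Above.irrefl _ (h''.trans h')]
  | @cons x a z hxa q ih =>
    cases g with
    | id => exact ⟨.id x, .cons hxa q, rfl, .refl _, h⟩
    | @cons _ b _ hxb g =>
      cases h with
      | cons _ hpq =>
        obtain ⟨g', g₁', rfl, hg, hg₁⟩ := ih hpq
        exact ⟨.cons hxa g', g₁', rfl, .cons hxa hg, hg₁⟩
      | skip _ hab _ hpq =>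
        obtain ⟨g', g₁', rfl, hg, hg₁⟩ := ih (g := .cons hab g) hpq
        exact ⟨.cons hxa g', g₁', rfl, .skip hxa hab hxb hg, hg₁⟩

end Sub

/-- If all steps had codimension one, `r` would equal the drop in dimension. Hence some step drops
by at least two, and `fill` inserts a cell into it. -/
theorem exists_sub_succ (fill : ∀ x y : Cell C, x.Above y → y.dim + 2 ≤ x.dim →
    ∃ c : Cell C, x.Above c ∧ c.Above y) {x y : Cell C} (p : Ent x y)
    (hp : p.r + y.dim < x.dim) : ∃ q, Sub p q ∧ q.r = p.r + 1 := by
  induction p with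
  | id => simp [r] at hp
  | @cons x a z h p ih =>
    by_cases hpr : p.r + z.dim < a.dim
    · obtain ⟨q, hq, hqr⟩ := ih hpr
      exact ⟨.cons h q, .cons h hq, by simp [r, hqr]⟩
    · simp only [r] at hp
      obtain ⟨c, hxc, hca⟩ := fill x a h (by omega)
      exact ⟨.cons hxc (.cons hca p), .skip hxc hca h (.refl _), by simp [r]⟩

end Ent

theorem SigmaPlus.r_add_dim {f : Cell C → ℝ} {x y : Cell C} {p : Ent x y} (h : SigmaPlus f p) :
    p.r + y.dim = x.dim := by
  cases h with
  | id => simp [Ent.r]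
  | mem h =>
    cases h with
    | pair h hp => have := hp.1; simp only [Ent.r]; omega

/-- Paths in Σ⁺ already have as many steps as the dimensions allow. -/
theorem SigmaPlus.eq_of_sub {f : Cell C → ℝ} {x y : Cell C} {p q : Ent x y} (h : SigmaPlus f p)
    (hpq : Ent.Sub p q) : p = q :=
  hpq.eq_of_r_le (by have := h.r_add_dim; have := q.r_add_dim_le; omega)

end Combinatorics

end DiscreteFlow

namespace DiscreteFlow

open Topology

/-! ### Zigzags, their refinements, and the order and rank on Hom sets. -/

section Zigzags

variable {X : Type*} [TopologicalSpace X] {C : Set X} [CWComplex C] {f : Cell C → ℝ} {z : Cell C}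

namespace Zigzag

/-! ### Invariance of the rank -/

theorem forward_precomp {x y : Cell C} (g : Ent x y) (t : Zigzag f z y) :
    (t.precomp g).forward = g.r + t.forward := by
  cases t <;> simp [precomp, forward, add_assoc]

theorem backward_precomp {x y : Cell C} (g : Ent x y) (t : Zigzag f z y) :
    (t.precomp g).backward = t.backward := by
  cases t <;> simp [precomp, backward]

theorem Horizontal.forward_eq {x : Cell C} {τ τ' : Zigzag f z x} (h : Horizontal τ τ') :
    τ.forward = τ'.forward := by
  induction h with
  | remove g h t => simp [forward, forward_precomp]
  | inside g b hb h ih => simp [forward, ih]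

theorem Horizontal.backward_eq {x : Cell C} {τ τ' : Zigzag f z x} (h : Horizontal τ τ') :
    τ.backward = τ'.backward := by
  induction h with
  | remove g h t => simp [backward, backward_precomp, Ent.r]
  | inside g b hb h ih => simp [backward, ih]

/-- A ladder whose squares commute. -/
abbrev CommLadder {x x' : Cell C} (v : Ent x x') (τ : Zigzag f z x) (τ' : Zigzag f z x') : Prop :=
  Ladder (fun _ _ p q => p = q) v τ τ'

theorem CommLadder.forward_add_backward {x x' : Cell C} {v : Ent x x'} {τ : Zigzag f z x}
    {τ' : Zigzag f z x'} (h : CommLadder v τ τ') :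
    v.r + τ'.forward + τ.backward = τ.forward + τ'.backward := by
  induction h with
  | last v g g' hg =>
    have := congrArg Ent.r hg
    simpa [forward, backward, Ent.r] using this
  | step v u v₁ hu hv₁ g g' hg b b' hb hb' hbb ht ih =>
    have h₁ := congrArg Ent.r hg
    have h₂ := congrArg Ent.r hbb
    simp only [Ent.r_comp] at h₁ h₂
    simp only [forward, backward]
    omega

theorem rank_eq_of_equiv {w : Cell C} {τ τ' : Zigzag f z w} (h : setoid f w z τ τ') :
    τ.rank = τ'.rank := by
  induction h with
  | rel τ τ' h =>
    rcases h with h | h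
    · simp [rank, h.forward_eq, h.backward_eq]
    · have := CommLadder.forward_add_backward h
      simp only [Ent.r] at this
      simp only [rank]
      omega
  | refl => rfl
  | symm _ _ _ ih => exact ih.symm
  | trans _ _ _ _ _ ih ih' => exact ih.trans ih'

/-- Each `gᵢ` has at most `dim xᵢ - dim yᵢ` steps and each `fᵢ` exactly `dim xᵢ₊₁ - dim yᵢ`; the sum
telescopes. -/
theorem forward_add_dim_le {x : Cell C} (τ : Zigzag f z x) :
    τ.forward + z.dim ≤ x.dim + τ.backward := by
  induction τ with
  | last g => simpa [forward, backward] using g.r_add_dim_le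
  | step g b hb t ih =>
    have := g.r_add_dim_le
    have := hb.r_add_dim
    simp only [forward, backward]
    omega

theorem rank_nonneg {w : Cell C} (τ : Zigzag f z w) : 0 ≤ τ.rank := by
  have := τ.forward_add_dim_le
  simp only [rank]
  omega

/-! ### Termwise refinement -/

/-- `τ.Finer σ`: the zigzag `σ` arises from `τ` by refining the forward morphisms. -/
inductive Finer : {x : Cell C} → Zigzag f z x → Zigzag f z x → Prop
  | last {x : Cell C} {g g' : Ent x z} (hg : g.Sub g') : Finer (last g) (last g')
  | step {x y x' : Cell C} {g g' : Ent x y} (hg : g.Sub g') (b : Ent x' y) (hb : SigmaPlus f b)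
      {t t' : Zigzag f z x'} (ht : Finer t t') : Finer (step g b hb t) (step g' b hb t')

namespace Finer

theorem refl {x : Cell C} (τ : Zigzag f z x) : τ.Finer τ := by
  induction τ with
  | last g => exact .last (.refl g)
  | step g b hb t ih => exact .step (.refl g) b hb ih

theorem trans {x : Cell C} {τ σ μ : Zigzag f z x} (h : τ.Finer σ) (h' : σ.Finer μ) :
    τ.Finer μ := by
  induction h with
  | last hg => cases h' with | last hg' => exact .last (hg.trans hg')
  | step hg b hb ht ih =>
    cases h' with | step hg' _ _ ht' => exact .step (hg.trans hg') b hb (ih ht')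

theorem backward_eq {x : Cell C} {τ σ : Zigzag f z x} (h : τ.Finer σ) :
    σ.backward = τ.backward := by
  induction h with
  | last => rfl
  | step hg b hb ht ih => simp [backward, ih]

theorem forward_le {x : Cell C} {τ σ : Zigzag f z x} (h : τ.Finer σ) :
    τ.forward ≤ σ.forward := by
  induction h with
  | last hg => exact hg.r_le
  | step hg b hb ht ih => exact add_le_add hg.r_le ih

theorem eq_of_forward_le {x : Cell C} {τ σ : Zigzag f z x} (h : τ.Finer σ)
    (hr : σ.forward ≤ τ.forward) : τ = σ := by
  induction h with
  | last hg => rw [hg.eq_of_r_le hr]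
  | step hg b hb ht ih =>
    have := hg.r_le
    have := ht.forward_le
    simp only [forward] at hr
    rw [hg.eq_of_r_le (by omega), ih (by omega)]

theorem exists_succ {x : Cell C} {τ σ : Zigzag f z x} (h : τ.Finer σ)
    (hr : τ.forward < σ.forward) :
    ∃ μ, τ.Finer μ ∧ μ.Finer σ ∧ μ.forward = τ.forward + 1 := by
  induction h with
  | last hg =>
    obtain ⟨m, hm, hm', hmr⟩ := hg.exists_succ hr
    exact ⟨_, .last hm, .last hm', hmr⟩
  | @step _ _ _ g g' hg b hb t t' ht ih =>
    by_cases hgr : g.r < g'.r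
    · obtain ⟨m, hm, hm', hmr⟩ := hg.exists_succ hgr
      exact ⟨_, .step hm b hb (.refl t), .step hm' b hb ht, by simp only [forward]; omega⟩
    · obtain ⟨m, hm, hm', hmr⟩ := ih (by simp only [forward] at hr; omega)
      exact ⟨_, .step (.refl g) b hb hm, .step hg b hb hm', by simp only [forward]; omega⟩

theorem rank_le {w : Cell C} {τ σ : Zigzag f z w} (h : τ.Finer σ) : σ.rank ≤ τ.rank := by
  have := h.forward_le
  have := h.backward_eq
  simp only [rank]
  omega

theorem eq_of_rank_le {w : Cell C} {τ σ : Zigzag f z w} (h : τ.Finer σ)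
    (hr : τ.rank ≤ σ.rank) : τ = σ := by
  have := h.backward_eq
  simp only [rank] at hr
  exact h.eq_of_forward_le (by omega)

theorem exists_rank_pred {w : Cell C} {τ σ : Zigzag f z w} (h : τ.Finer σ)
    (hr : σ.rank < τ.rank) : ∃ μ, τ.Finer μ ∧ μ.Finer σ ∧ μ.rank + 1 = τ.rank := by
  have := h.backward_eq
  simp only [rank] at hr
  obtain ⟨μ, hμ, hμ', hμr⟩ := h.exists_succ (by omega)
  have := hμ.backward_eq
  refine ⟨μ, hμ, hμ', ?_⟩
  simp only [rank]
  omega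

theorem precomp {x y : Cell C} {g g' : Ent x y} (hg : g.Sub g') {t t' : Zigzag f z y}
    (ht : t.Finer t') : (t.precomp g).Finer (t'.precomp g') := by
  cases ht with
  | last h => exact .last (hg.comp h)
  | step h b hb ht => exact .step (hg.comp h) b hb ht

theorem split {x y : Cell C} {g : Ent x y} {t : Zigzag f z y} {σ : Zigzag f z x}
    (h : (t.precomp g).Finer σ) :
    ∃ (g' : Ent x y) (t' : Zigzag f z y), σ = t'.precomp g' ∧ g.Sub g' ∧ t.Finer t' := by
  cases t with
  | last g₁ =>
    cases h with
    | last h =>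
      obtain ⟨g', g₁', rfl, hg, hg₁⟩ := h.split
      exact ⟨g', .last g₁', rfl, hg, .last hg₁⟩
  | step g₁ b hb t =>
    cases h with
    | step h _ _ ht =>
      obtain ⟨g', g₁', rfl, hg, hg₁⟩ := h.split
      exact ⟨g', .step g₁' b hb _, rfl, hg, .step hg₁ b hb ht⟩

end Finer

theorem exists_finer_rank_pred (fill : ∀ x y : Cell C, x.Above y → y.dim + 2 ≤ x.dim →
    ∃ c : Cell C, x.Above c ∧ c.Above y) {w : Cell C} (τ : Zigzag f z w) (hτ : 0 < τ.rank) :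
    ∃ σ, τ.Finer σ ∧ σ.rank + 1 = τ.rank := by
  suffices H : ∀ (x : Cell C) (τ : Zigzag f z x), τ.forward + z.dim < x.dim + τ.backward →
      ∃ σ, τ.Finer σ ∧ σ.forward = τ.forward + 1 by
    obtain ⟨σ, hσ, hσr⟩ := H _ τ (by simp only [rank] at hτ; omega)
    have := hσ.backward_eq
    refine ⟨σ, hσ, ?_⟩
    simp only [rank]
    omega
  intro x τ hτ
  induction τ with
  | last g =>
    obtain ⟨q, hq, hqr⟩ := g.exists_sub_succ fill (by simpa [forward, backward] using hτ)
    exact ⟨_, .last hq, hqr⟩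
  | @step x y x' g b hb t ih =>
    by_cases hg : g.r + y.dim < x.dim
    · obtain ⟨q, hq, hqr⟩ := g.exists_sub_succ fill hg
      exact ⟨_, .step hq b hb (.refl t), by simp only [forward]; omega⟩
    · obtain ⟨q, hq, hqr⟩ := ih (by
        have := hb.r_add_dim
        simp only [forward, backward] at hτ
        omega)
      exact ⟨_, .step (.refl g) b hb hq, by simp only [forward]; omega⟩

/-! ### Lifting refinements along the generating relations -/

theorem Horizontal.lift {x : Cell C} {τ τ' σ : Zigzag f z x} (h : Horizontal τ τ')
    (hσ : τ.Finer σ) : ∃ σ', τ'.Finer σ' ∧ Horizontal σ σ' := by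
  induction h with
  | remove g h t =>
    cases hσ with
    | step hg _ _ ht => exact ⟨_, .precomp hg ht, .remove _ _ _⟩
  | inside g b hb h ih =>
    cases hσ with
    | step hg _ _ ht =>
      obtain ⟨σ', hσ', h'⟩ := ih ht
      exact ⟨_, .step hg b hb hσ', .inside _ b hb h'⟩

theorem Horizontal.lift' {x : Cell C} {τ τ' σ' : Zigzag f z x} (h : Horizontal τ τ')
    (hσ : τ'.Finer σ') : ∃ σ, τ.Finer σ ∧ Horizontal σ σ' := by
  induction h with
  | remove g h t =>
    obtain ⟨g', t', rfl, hg, ht⟩ := hσ.split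
    exact ⟨_, .step hg _ h ht, .remove _ _ _⟩
  | inside g b hb h ih =>
    cases hσ with
    | step hg _ _ ht =>
      obtain ⟨σ', hσ', h'⟩ := ih ht
      exact ⟨_, .step hg b hb hσ', .inside _ b hb h'⟩

/-- In each square the top composite refines `v` followed by `g'`, so it splits accordingly. The
first factor must be `v` again, and the second is the refinement of `g'` that makes the square
commute. -/
theorem exists_finer_commLadder {x x' : Cell C} {v : Ent x x'} (hv : SigmaPlus f v)
    {τ : Zigzag f z x} {τ' : Zigzag f z x'} (h : Ladder (fun _ _ p q => p.Refines q) v τ τ') :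
    ∃ σ', τ'.Finer σ' ∧ CommLadder v τ σ' := by
  induction h with
  | last v g g' hg =>
    obtain ⟨v', g₁, h, hv', hg₁⟩ := (Ent.Sub.of_refines hg).split
    obtain rfl := hv.eq_of_sub hv'
    exact ⟨_, .last hg₁, .last _ _ _ h.symm⟩
  | step v u v₁ hu hv₁ g g' hg b b' hb hb' hbb ht ih =>
    obtain ⟨v', g₁, h, hv', hg₁⟩ := (Ent.Sub.of_refines hg).split
    obtain rfl := hv.eq_of_sub hv'
    obtain ⟨σ', hσ', h'⟩ := ih hv₁
    refine ⟨_, .step hg₁ b' hb' hσ', .step _ u v₁ hu hv₁ _ _ h.symm _ _ _ _ ?_ h'⟩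
    -- All four arrows lie in Σ⁺, so both composites have `r` equal to the drop in dimension: this
    -- square already commutes.
    refine (Ent.Sub.of_refines hbb).eq_of_r_le ?_
    have := hu.r_add_dim
    have := hv₁.r_add_dim
    have := hb.r_add_dim
    have := hb'.r_add_dim
    simp only [Ent.r_comp]
    omega

theorem CommLadder.refines_of_finer {x x' : Cell C} {v : Ent x x'} {τ σ : Zigzag f z x}
    {τ' : Zigzag f z x'} (h : CommLadder v τ τ') (hσ : τ.Finer σ) :
    Ladder (fun _ _ p q => p.Refines q) v σ τ' := by
  induction h with
  | last v g g' hg =>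
    cases hσ with
    | last h => exact .last _ _ _ (hg ▸ (h.comp (.refl _)).refines)
  | step v u v₁ hu hv₁ g g' hg b b' hb hb' hbb ht ih =>
    cases hσ with
    | step h _ _ ht' =>
      exact .step _ u v₁ hu hv₁ _ _ (hg ▸ (h.comp (.refl _)).refines) _ _ _ _
        (hbb ▸ (Ent.Sub.refl _).refines) (ih ht')

/-- The refined bottom composite is split along `g` followed by `u`; as `u` is rigid, the whole
refinement is absorbed by `g`. -/
theorem CommLadder.lift' {x x' : Cell C} {v : Ent x x'} {τ : Zigzag f z x}
    {τ' σ' : Zigzag f z x'} (h : CommLadder v τ τ') (hσ : τ'.Finer σ') :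
    ∃ σ, τ.Finer σ ∧ CommLadder v σ σ' := by
  induction h with
  | last v g g' hg =>
    cases hσ with
    | @last _ _ g₁ h =>
      refine ⟨.last (v.comp g₁), .last ?_, .last _ _ _ (Ent.comp_id _).symm⟩
      rw [Ent.comp_id] at hg
      exact hg ▸ (Ent.Sub.refl v).comp h
  | step v u v₁ hu hv₁ g g' hg b b' hb hb' hbb ht ih =>
    cases hσ with
    | step h _ _ ht' =>
      obtain ⟨g₁, u₁, h', hg₁, hu₁⟩ := Ent.Sub.split (hg ▸ (Ent.Sub.refl v).comp h)
      obtain rfl := hu.eq_of_sub hu₁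
      obtain ⟨σ, hσ, hσ'⟩ := ih ht'
      exact ⟨_, .step hg₁ b hb hσ, .step _ _ v₁ hu hv₁ _ _ h' _ _ _ _ hbb hσ'⟩

theorem ladder_of_finer {x : Cell C} {τ σ : Zigzag f z x} (h : τ.Finer σ) :
    Ladder (fun _ _ p q => p.Refines q) (Ent.id x) σ τ := by
  induction h with
  | last hg => exact .last _ _ _ (by simpa [Ent.comp] using hg.refines)
  | step hg b hb ht ih =>
    exact .step _ (.id _) (.id _) (.id _) (.id _) _ _ (by simpa [Ent.comp] using hg.refines) _ _ _ _
      (by simpa [Ent.comp] using (Ent.Sub.refl b).refines) ih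

theorem exists_finer_equiv {w : Cell C} {τ τ' : Zigzag f z w} (h : setoid f w z τ τ') :
    (∀ σ, τ.Finer σ → ∃ σ', τ'.Finer σ' ∧ setoid f w z σ σ') ∧
      ∀ σ', τ'.Finer σ' → ∃ σ, τ.Finer σ ∧ setoid f w z σ σ' := by
  induction h with
  | rel τ τ' h =>
    rcases h with h | h
    · refine ⟨fun σ hσ => ?_, fun σ' hσ' => ?_⟩
      · obtain ⟨σ', h₁, h₂⟩ := h.lift hσ
        exact ⟨σ', h₁, .rel _ _ (.inl h₂)⟩
      · obtain ⟨σ, h₁, h₂⟩ := h.lift' hσ'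
        exact ⟨σ, h₁, .rel _ _ (.inl h₂)⟩
    · refine ⟨fun σ hσ => ?_, fun σ' hσ' => ?_⟩
      -- Refining only the top row leaves weak squares; refining the bottom row in turn restores
      -- commutativity.
      · obtain ⟨σ', h₁, h₂⟩ := exists_finer_commLadder (.id w) (CommLadder.refines_of_finer h hσ)
        exact ⟨σ', h₁, .rel _ _ (.inr h₂)⟩
      · obtain ⟨σ, h₁, h₂⟩ := CommLadder.lift' h hσ'
        exact ⟨σ, h₁, .rel _ _ (.inr h₂)⟩
  | refl τ => exact ⟨fun σ h => ⟨σ, h, .refl _⟩, fun σ h => ⟨σ, h, .refl _⟩⟩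
  | symm τ τ' _ ih =>
    refine ⟨fun σ hσ => ?_, fun σ' hσ' => ?_⟩
    · obtain ⟨σ', h₁, h₂⟩ := ih.2 σ hσ
      exact ⟨σ', h₁, .symm _ _ h₂⟩
    · obtain ⟨σ, h₁, h₂⟩ := ih.1 σ' hσ'
      exact ⟨σ, h₁, .symm _ _ h₂⟩
  | trans τ₁ τ₂ τ₃ _ _ ih ih' =>
    refine ⟨fun σ hσ => ?_, fun σ' hσ' => ?_⟩
    · obtain ⟨σ₂, h₁, h₂⟩ := ih.1 σ hσ
      obtain ⟨σ₃, h₃, h₄⟩ := ih'.1 σ₂ h₁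
      exact ⟨σ₃, h₃, .trans _ _ _ h₂ h₄⟩
    · obtain ⟨σ₂, h₁, h₂⟩ := ih'.2 σ' hσ'
      obtain ⟨σ₁, h₃, h₄⟩ := ih.2 σ₂ h₁
      exact ⟨σ₁, h₃, .trans _ _ _ h₄ h₂⟩

end Zigzag

/-! ### The order on the morphisms of the flow category -/

namespace FlowHom

open Zigzag

variable {w : Cell C}

theorem mk_eq_mk {τ τ' : Zigzag f z w} : mk τ = mk τ' ↔ setoid f w z τ τ' :=
  Quotient.eq

theorem exists_mk (γ : FlowHom f w z) : ∃ τ, mk τ = γ := Quotient.exists_rep γ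

/-- Since `τ` is arbitrary in its class, one representative can be refined successively along a
chain of relations. -/
theorem implies_mk_iff {τ : Zigzag f z w} {γ : FlowHom f w z} :
    Implies (mk τ) γ ↔ ∃ σ, τ.Finer σ ∧ mk σ = γ := by
  constructor
  · rintro ⟨τ₁, τ', rfl, h, hL⟩
    obtain ⟨σ', hσ', hL'⟩ := exists_finer_commLadder (.id w) hL
    obtain ⟨σ, hσ, hσσ'⟩ := (exists_finer_equiv (mk_eq_mk.1 h.symm)).2 σ' hσ'
    exact ⟨σ, hσ, mk_eq_mk.2 (.trans _ _ _ hσσ' (.symm _ _ (.rel _ _ (.inr hL'))))⟩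
  · rintro ⟨σ, hσ, rfl⟩
    exact ⟨σ, τ, rfl, rfl, ladder_of_finer hσ⟩

/-- The rank of a morphism of the flow category. -/
def rank (γ : FlowHom f w z) : ℤ :=
  Quotient.lift Zigzag.rank (fun _ _ => rank_eq_of_equiv) γ

theorem rank_nonneg (γ : FlowHom f w z) : 0 ≤ γ.rank := by
  obtain ⟨τ, rfl⟩ := γ.exists_mk
  exact τ.rank_nonneg

theorem Implies.rank_le {γ γ' : FlowHom f w z} (h : γ.Implies γ') : γ'.rank ≤ γ.rank := by
  obtain ⟨τ, rfl⟩ := γ.exists_mk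
  obtain ⟨σ, hσ, rfl⟩ := implies_mk_iff.1 h
  exact hσ.rank_le

theorem Implies.eq_of_rank_le {γ γ' : FlowHom f w z} (h : γ.Implies γ')
    (hr : γ.rank ≤ γ'.rank) : γ = γ' := by
  obtain ⟨τ, rfl⟩ := γ.exists_mk
  obtain ⟨σ, hσ, rfl⟩ := implies_mk_iff.1 h
  rw [hσ.eq_of_rank_le hr]

theorem Implies.exists_rank_pred {γ γ' : FlowHom f w z} (h : γ.Implies γ')
    (hr : γ'.rank < γ.rank) :
    ∃ δ : FlowHom f w z, γ.Implies δ ∧ δ.Implies γ' ∧ δ.rank + 1 = γ.rank := by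
  obtain ⟨τ, rfl⟩ := γ.exists_mk
  obtain ⟨σ, hσ, rfl⟩ := implies_mk_iff.1 h
  obtain ⟨μ, h₁, h₂, h₃⟩ := hσ.exists_rank_pred hr
  exact ⟨mk μ, implies_mk_iff.2 ⟨μ, h₁, rfl⟩, implies_mk_iff.2 ⟨σ, h₂, rfl⟩, h₃⟩

theorem exists_implies_rank_pred (fill : ∀ x y : Cell C, x.Above y → y.dim + 2 ≤ x.dim →
    ∃ c : Cell C, x.Above c ∧ c.Above y) {γ : FlowHom f w z} (hγ : 0 < γ.rank) :
    ∃ δ : FlowHom f w z, γ.Implies δ ∧ δ.rank + 1 = γ.rank := by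
  obtain ⟨τ, rfl⟩ := γ.exists_mk
  obtain ⟨σ, h, h'⟩ := τ.exists_finer_rank_pred fill hγ
  exact ⟨mk σ, implies_mk_iff.2 ⟨σ, h, rfl⟩, h'⟩

/-- The partial order on the morphisms of the flow category. -/
@[reducible] def partialOrder (f : Cell C → ℝ) (w z : Cell C) : PartialOrder (FlowHom f w z) where
  le := Implies
  le_refl γ := by
    obtain ⟨τ, rfl⟩ := γ.exists_mk
    exact implies_mk_iff.2 ⟨τ, .refl τ, rfl⟩
  le_trans γ₁ γ₂ γ₃ h h' := by
    obtain ⟨τ, rfl⟩ := γ₁.exists_mk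
    obtain ⟨σ, hσ, rfl⟩ := implies_mk_iff.1 h
    obtain ⟨μ, hμ, rfl⟩ := implies_mk_iff.1 h'
    exact implies_mk_iff.2 ⟨μ, hσ.trans hμ, rfl⟩
  -- Relations both ways force equal ranks, and a refinement that does not lower the rank is
  -- trivial.
  le_antisymm _ _ h h' := Implies.eq_of_rank_le h (Implies.rank_le h')

attribute [local instance] partialOrder

/-- The extension of the rank by `-1` to the opposite poset with a least element adjoined. -/
def extendedRank (x : WithBot (FlowHom f w z)ᵒᵈ) : ℤ :=
  x.recBotCoe (-1) fun γ => (OrderDual.ofDual γ).rank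

theorem isRankFunction_extendedRank (fill : ∀ x y : Cell C, x.Above y → y.dim + 2 ≤ x.dim →
    ∃ c : Cell C, x.Above c ∧ c.Above y) :
    IsRankFunction (extendedRank : WithBot (FlowHom f w z)ᵒᵈ → ℤ) where
  strict x y h := by
    induction x with
    | bot => exact (not_lt_bot h).elim
    | coe γ =>
      have h0 := (OrderDual.ofDual γ).rank_nonneg
      induction y with
      | bot => change -1 < (OrderDual.ofDual γ).rank; omega
      | coe δ =>
        have h : OrderDual.ofDual γ < OrderDual.ofDual δ :=
          OrderDual.ofDual_lt_ofDual.2 (WithBot.coe_lt_coe.1 h)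
        have h₁ : Implies (OrderDual.ofDual γ) (OrderDual.ofDual δ) := h.le
        change (OrderDual.ofDual δ).rank < (OrderDual.ofDual γ).rank
        by_contra! hr
        exact h.ne (h₁.eq_of_rank_le hr)
  cover x y h := by
    induction x with
    | bot => exact (not_lt_bot h.lt).elim
    | coe γ =>
      have h0 := (OrderDual.ofDual γ).rank_nonneg
      induction y with
      | bot =>
        change (OrderDual.ofDual γ).rank = -1 + 1
        by_contra hr
        -- If the rank were positive, a refinement of rank one less would lie strictly between `⊥`
        -- and `γ`.
        obtain ⟨δ, hδ, hδr⟩ := exists_implies_rank_pred fill (γ := OrderDual.ofDual γ) (by omega)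
        refine h.2 (WithBot.bot_lt_coe (OrderDual.toDual δ)) (WithBot.coe_lt_coe.2 ?_)
        change OrderDual.ofDual γ < δ
        refine lt_of_le_of_ne hδ ?_
        intro he
        rw [he] at hδr
        omega
      | coe δ =>
        have h' : OrderDual.ofDual γ < OrderDual.ofDual δ :=
          OrderDual.ofDual_lt_ofDual.2 (WithBot.coe_lt_coe.1 h.lt)
        have h₁ : Implies (OrderDual.ofDual γ) (OrderDual.ofDual δ) := h'.le
        change (OrderDual.ofDual γ).rank = (OrderDual.ofDual δ).rank + 1
        obtain ⟨μ, hμ, hμ', hμr⟩ := h₁.exists_rank_pred (by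
          by_contra! hr
          exact h'.ne (h₁.eq_of_rank_le hr))
        by_contra hr
        refine h.2 (c := WithBot.some (OrderDual.toDual μ)) (WithBot.coe_lt_coe.2 ?_)
          (WithBot.coe_lt_coe.2 ?_)
        · change μ < OrderDual.ofDual δ
          refine lt_of_le_of_ne hμ' ?_
          intro he
          rw [he] at hμr
          omega
        · change OrderDual.ofDual γ < μ
          refine lt_of_le_of_ne hμ ?_
          intro he
          rw [he] at hμr
          omega

end FlowHom

end Zigzags

end DiscreteFlow

namespace DiscreteFlow

/-! ### Nonexistence of retractions, zeros of maps near the identity, and invariance of domain. -/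

section InvarianceOfDomain

open MeasureTheory Metric Topology

/-! ### A zero of maps that are the identity near infinity -/

/-- The determinant is a polynomial in `t` of degree at most `dim E`. Interpolation at fixed nodes
lets an integral identity known for small `t` be carried to `t = 1`. -/
theorem det_one_add_eq_sum_lagrange {E : Type*} [NormedAddCommGroup E] [NormedSpace ℝ E]
    [FiniteDimensional ℝ E] (s : Finset ℝ) (hs : Module.finrank ℝ E < s.card) (A : E →L[ℝ] E)
    (t : ℝ) : (1 + t • A).det = ∑ a ∈ s, (1 + a • A).det * (Lagrange.basis s id a).eval t := by
  let b := Module.finBasis ℝ E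
  let M := LinearMap.toMatrix b b (A : E →ₗ[ℝ] E)
  let P : Polynomial ℝ :=
    ((Polynomial.X : Polynomial ℝ) • M.map Polynomial.C +
      (1 : Matrix (Fin (Module.finrank ℝ E)) (Fin (Module.finrank ℝ E)) ℝ).map Polynomial.C).det
  have hP : ∀ t : ℝ, P.eval t = (1 + t • A).det := by
    intro t
    rw [ContinuousLinearMap.det, ← LinearMap.det_toMatrix b]
    simp only [P]
    rw [← Polynomial.coe_evalRingHom, RingHom.map_det]
    congr 1
    ext i j
    simp [M, LinearMap.toMatrix_apply, Matrix.one_apply, apply_ite,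
      Finsupp.single_apply, eq_comm, add_comm]
    exact mul_comm _ _
  have hdeg : P.degree < s.card := by
    refine lt_of_le_of_lt Polynomial.degree_le_natDegree ?_
    refine lt_of_le_of_lt (Nat.cast_le.2 (Polynomial.natDegree_det_X_add_C_le _ _)) ?_
    simpa using hs
  have := Lagrange.eq_interpolate (v := id) (Function.injective_id.injOn) hdeg
  rw [← hP, this]
  simp [Lagrange.interpolate_apply, Polynomial.eval_finsetSum, ← hP]

/-- The integral over the ball of the Jacobian of `x + t (ρ x - x)` is polynomial in `t`. For small
`t > 0` this map is a bijection of the ball, so the integral is the volume; at `t = 1` the map is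
`ρ`, whose Jacobian vanishes. -/
theorem not_retraction_closedBall {E : Type*} [NormedAddCommGroup E] [InnerProductSpace ℝ E]
    [FiniteDimensional ℝ E] {R : ℝ} (hR : 0 < R) {ρ : E → E} (hρ : ContDiff ℝ 1 ρ)
    (hnorm : ∀ x, ‖ρ x‖ = R) (hid : ∀ x, ‖x‖ = R → ρ x = x) : False := by
  let _ : MeasurableSpace E := borel E
  have _ : BorelSpace E := ⟨rfl⟩
  let B : Set E := closedBall 0 R
  have hBc : IsCompact B := isCompact_closedBall 0 R
  let A : E → E →L[ℝ] E := fun x => fderiv ℝ ρ x - 1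
  have hAc : Continuous A := (hρ.continuous_fderiv one_ne_zero).sub continuous_const
  have hA : ∀ x, HasFDerivAt (fun x => ρ x - x) (A x) x := fun x =>
    ((hρ.differentiable one_ne_zero x).hasFDerivAt).sub (hasFDerivAt_id x)
  obtain ⟨L₀, hL₀⟩ := hBc.exists_bound_of_continuousOn hAc.continuousOn
  let L : ℝ := max L₀ 1
  have hLpos : 0 < L := lt_of_lt_of_le one_pos (le_max_right _ _)
  have hL : ∀ x ∈ B, ‖A x‖ ≤ L := fun x hx => (hL₀ x hx).trans (le_max_left _ _)
  have hLip : ∀ x ∈ B, ∀ y ∈ B, ‖(ρ x - x) - (ρ y - y)‖ ≤ L * ‖x - y‖ := fun x hx y hy =>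
    (convex_closedBall 0 R).norm_image_sub_le_of_norm_hasFDerivWithin_le
      (fun x _ => (hA x).hasFDerivWithinAt) hL hy hx
  -- extension by zero
  classical
  let h : E → E := fun x => if x ∈ B then ρ x - x else 0
  have hmix : ∀ x ∈ B, ∀ y ∉ B, ‖h x - h y‖ ≤ L * ‖x - y‖ := by
    intro x hx y hy
    -- The segment crosses the sphere, where `ρ - id` vanishes, so the Lipschitz bound inside the
    -- ball suffices.
    have hseg : ∃ m ∈ segment ℝ x y, ‖m‖ = R := by
      have hx' : ‖x‖ ≤ R := by simpa [B] using hx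
      have hy' : R ≤ ‖y‖ := by
        have : R < ‖y‖ := by simpa [B] using hy
        exact this.le
      have := (convex_segment x y).isPreconnected.intermediate_value (left_mem_segment ℝ x y)
        (right_mem_segment ℝ x y) (f := fun m : E => ‖m‖) continuous_norm.continuousOn ⟨hx', hy'⟩
      simpa using this
    obtain ⟨m, hm, hmR⟩ := hseg
    have hmB : m ∈ B := by simp [B, hmR]
    have h0 : ρ m - m = 0 := by rw [hid m hmR, sub_self]
    have h1 := hLip x hx m hmB
    rw [h0] at h1
    simp only [h, if_pos hx, if_neg hy]
    refine h1.trans (mul_le_mul_of_nonneg_left ?_ hLpos.le)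
    obtain ⟨a, b, ha, hb, hab, rfl⟩ := hm
    have : x - (a • x + b • y) = b • (x - y) := by
      have : a = 1 - b := by linarith
      subst this
      module
    rw [this, norm_smul, Real.norm_of_nonneg hb]
    exact mul_le_of_le_one_left (norm_nonneg _) (by linarith)
  have hLip' : ∀ x y, ‖h x - h y‖ ≤ L * ‖x - y‖ := by
    intro x y
    by_cases hx : x ∈ B <;> by_cases hy : y ∈ B
    · simpa only [h, if_pos hx, if_pos hy] using hLip x hx y hy
    · exact hmix x hx y hy
    · rw [norm_sub_rev, norm_sub_rev x]; exact hmix y hy x hx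
    · simpa only [h, if_neg hx, if_neg hy, sub_self, norm_zero] using
        mul_nonneg hLpos.le (norm_nonneg _)
  -- small parameters
  obtain ⟨η, hη, hdet⟩ : ∃ η > 0, ∀ M : E →L[ℝ] E, ‖M‖ < η → 0 < (1 + M).det := by
    have hc : Continuous fun M : E →L[ℝ] E => (1 + M).det :=
      ContinuousLinearMap.continuous_det.comp (continuous_const.add continuous_id)
    have := (hc.isOpen_preimage _ isOpen_Ioi).mem_nhds (x := 0) (s := _ ⁻¹' Set.Ioi (0:ℝ))
      (by simp [ContinuousLinearMap.det])
    obtain ⟨η, hη, hs⟩ := Metric.mem_nhds_iff.1 this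
    exact ⟨η, hη, fun M hM => hs (by simpa using hM)⟩
  -- For `t < ε`, the bound `η` keeps determinants positive and `1/2` gives a contraction; `1 ≤ L`
  -- then also yields `t < 1`.
  let ε : ℝ := min η (1/2) / L
  have hε : 0 < ε := by positivity
  have hsmall : ∀ t ∈ Set.Ioo 0 ε, t * L < η ∧ t * L < 1 ∧ t < 1 := by
    intro t ht
    have h1 : t * L < min η (1/2) := (lt_div_iff₀ hLpos).1 ht.2
    have h2 := h1.trans_le (min_le_left _ _)
    have h3 := h1.trans_le (min_le_right _ _)
    have h4 : t ≤ t * L := le_mul_of_one_le_right ht.1.le (le_max_right _ _)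
    exact ⟨h2, by linarith, by linarith⟩
  have hvol : ∀ t ∈ Set.Ioo 0 ε, ∫ x in B, (1 + t • A x).det = volume.real B := by
    intro t ht
    obtain ⟨ht1, ht2, ht3⟩ := hsmall t ht
    let φ : E → E := fun x => x + t • (ρ x - x)
    have hφ : ∀ x ∈ B, HasFDerivWithinAt φ (1 + t • A x) B x := fun x _ =>
      ((hasFDerivAt_id x).add ((hA x).const_smul t)).hasFDerivWithinAt
    have hinj : Set.InjOn φ B := by
      intro x hx y hy hxy
      by_contra hne
      have hpos : 0 < ‖x - y‖ := norm_pos_iff.2 (sub_ne_zero.2 hne)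
      have h1 : x - y = - (t • ((ρ x - x) - (ρ y - y))) := by
        have : x + t • (ρ x - x) = y + t • (ρ y - y) := hxy
        rw [smul_sub, ← sub_eq_zero]
        rw [← sub_eq_zero] at this
        rw [← this]
        abel
      have h2 : ‖x - y‖ ≤ t * (L * ‖x - y‖) := by
        conv_lhs => rw [h1, norm_neg, norm_smul, Real.norm_of_nonneg ht.1.le]
        exact mul_le_mul_of_nonneg_left (hLip x hx y hy) ht.1.le
      nlinarith
    have himg : φ '' B = B := by
      apply Set.Subset.antisymm
      · rintro _ ⟨x, hx, rfl⟩
        have : φ x = (1 - t) • x + t • ρ x := by simp only [φ]; module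
        rw [this]
        refine convex_closedBall (0 : E) R hx ?_ (by linarith) ht.1.le (by ring)
        simp [hnorm]
      · intro y hy
        -- Solving `φ x = y` is a fixed-point problem. With `h` extended by zero it makes sense on
        -- all of `E`, and a fixed point outside `B` would be `y` itself, which lies in `B`.
        have hK : ContractingWith (Real.toNNReal (t * L)) fun x => y - t • h x := by
          refine ⟨by simpa using ht2, LipschitzWith.of_dist_le_mul fun x x' => ?_⟩
          rw [dist_eq_norm, dist_eq_norm, Real.coe_toNNReal _ (mul_nonneg ht.1.le hLpos.le)]
          have : y - t • h x - (y - t • h x') = - (t • (h x - h x')) := by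
            rw [smul_sub]; abel
          rw [this, norm_neg, norm_smul, Real.norm_of_nonneg ht.1.le, mul_assoc]
          exact mul_le_mul_of_nonneg_left (hLip' x x') ht.1.le
        have hfix : y - t • h (ContractingWith.fixedPoint _ hK) = ContractingWith.fixedPoint _ hK :=
          hK.fixedPoint_isFixedPt
        set x := ContractingWith.fixedPoint _ hK
        have hxB : x ∈ B := by
          by_contra hxB
          simp only [h, if_neg hxB, smul_zero, sub_zero] at hfix
          exact hxB (hfix ▸ hy)
        refine ⟨x, hxB, ?_⟩
        simp only [h, if_pos hxB] at hfix
        simp only [φ]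
        nth_rewrite 1 [← hfix]
        abel
    have key := integral_image_eq_integral_abs_det_fderiv_smul volume
      (measurableSet_closedBall (x := (0 : E)) (ε := R)) hφ hinj (fun _ => (1 : ℝ))
    change ∫ x in φ '' B, (1 : ℝ) = ∫ x in B, _ at key
    rw [himg] at key
    simp only [integral_const, smul_eq_mul, mul_one, measureReal_restrict_apply_univ] at key
    rw [key]
    refine setIntegral_congr_fun measurableSet_closedBall fun x hx => ?_
    refine (abs_of_pos (hdet _ ?_)).symm
    rw [norm_smul, Real.norm_of_nonneg ht.1.le]
    exact lt_of_le_of_lt (mul_le_mul_of_nonneg_left (hL x hx) ht.1.le) ht1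
  obtain ⟨s, hs, hcard⟩ := (Set.Ioo_infinite hε).exists_subset_card_eq (Module.finrank ℝ E + 1)
  -- The image of the derivative is orthogonal to `ρ x`, because `‖ρ‖` is constant; an invertible
  -- derivative would have `ρ x ≠ 0` in its image.
  have hzero : ∀ x, (1 + (1 : ℝ) • A x).det = 0 := by
    intro x
    have hAx : 1 + (1 : ℝ) • A x = fderiv ℝ ρ x := by simp [A]
    rw [hAx]
    by_contra hne
    have hρx : ρ x ≠ 0 := fun h0 => by simpa [h0, hR.ne] using hnorm x
    have hd := (hρ.differentiable one_ne_zero x).hasFDerivAt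
    have h1 := hd.inner ℝ hd
    have h2 : HasFDerivAt (fun y => inner ℝ (ρ y) (ρ y)) (0 : E →L[ℝ] ℝ) x := by
      have : (fun y => inner ℝ (ρ y) (ρ y)) = fun _ => R ^ 2 := by
        ext y; rw [real_inner_self_eq_norm_sq, hnorm]
      rw [this]
      exact hasFDerivAt_const _ _
    have h3 := h1.unique h2
    obtain ⟨v, hv⟩ : ∃ v, fderiv ℝ ρ x v = ρ x := by
      exact (LinearMap.equivOfDetNeZero (fderiv ℝ ρ x : E →ₗ[ℝ] E) hne).surjective (ρ x)
    have h4 := congrArg (fun l : E →L[ℝ] ℝ => l v) h3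
    simp [fderivInnerCLM_apply, hv] at h4
    exact hρx h4
  have hint : ∀ a : ℝ, IntegrableOn (fun x => (1 + a • A x).det) B := fun a =>
    (ContinuousLinearMap.continuous_det.comp
      (continuous_const.add (hAc.const_smul a))).continuousOn.integrableOn_compact hBc
  have hfinal : (0 : ℝ) = volume.real B := by
    have h1 : ∫ x in B, (1 + (1 : ℝ) • A x).det = 0 := by simp only [hzero, integral_zero]
    rw [← h1]
    have h2 : ∀ x, (1 + (1 : ℝ) • A x).det =
        ∑ a ∈ s, (1 + a • A x).det * (Lagrange.basis s id a).eval 1 := fun x =>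
      det_one_add_eq_sum_lagrange s (by omega) (A x) 1
    simp_rw [h2]
    rw [integral_finsetSum _ fun a _ => (hint a).mul_const _]
    simp_rw [integral_mul_const]
    rw [Finset.sum_congr rfl fun a ha => by rw [hvol a (hs ha)], ← Finset.mul_sum,
      ← Polynomial.eval_finsetSum, Lagrange.sum_basis Function.injective_id.injOn
        (Finset.card_pos.1 (by omega))]
    simp
  have hpos : 0 < volume.real B := by
    refine ENNReal.toReal_pos (measure_closedBall_pos _ _ hR).ne' (hBc.measure_lt_top).ne
  linarith

variable {E : Type*} [NormedAddCommGroup E] [InnerProductSpace ℝ E] [FiniteDimensional ℝ E]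

open scoped Manifold ContDiff in
theorem exists_contDiff_forall_mem_convex {t : E → Set E} (ht : ∀ x, Convex ℝ (t x))
    (hloc : ∀ x, ∃ c, ∀ᶠ y in 𝓝 x, c ∈ t y) : ∃ k : E → E, ContDiff ℝ 1 k ∧ ∀ x, k x ∈ t x := by
  obtain ⟨g, hg⟩ := exists_contMDiffMap_forall_mem_convex_of_local_const (n := 1) 𝓘(ℝ, E) ht hloc
  exact ⟨g, contMDiff_iff_contDiff.1 g.contMDiff, hg⟩

theorem exists_contDiff_dist_lt {g : E → E} (hg : Continuous g) {δ : ℝ} (hδ : 0 < δ) :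
    ∃ k : E → E, ContDiff ℝ 1 k ∧ ∀ x, ‖k x - g x‖ < δ := by
  obtain ⟨k, hk, hk'⟩ := exists_contDiff_forall_mem_convex (t := fun x => ball (g x) δ)
    (fun x => convex_ball _ _) (fun x => ⟨g x, by
      filter_upwards [hg.continuousAt.preimage_mem_nhds (ball_mem_nhds (g x) hδ)] with y hy
      exact mem_ball_comm.1 hy⟩)
  exact ⟨k, hk, fun x => mem_ball_iff_norm.1 (hk' x)⟩

/-- Without zeros, `F` rescaled to norm `R` would be a retraction onto the sphere. -/
theorem exists_zero_of_contDiff_of_eq_self {R : ℝ} (hR : 0 < R) {F : E → E} (hF : ContDiff ℝ 1 F)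
    (hid : ∀ x, R ≤ ‖x‖ → F x = x) : ∃ x, F x = 0 := by
  by_contra! h0
  refine not_retraction_closedBall hR (ρ := fun x => (R / ‖F x‖) • F x) ?_ ?_ ?_
  · exact (contDiff_const.div (hF.norm ℝ h0) fun x => norm_ne_zero_iff.2 (h0 x)).smul hF
  · intro x
    rw [norm_smul, Real.norm_of_nonneg (by positivity),
      div_mul_cancel₀ _ (norm_ne_zero_iff.2 (h0 x))]
  · intro x hx
    simp only [hid x hx.ge]
    rw [hx, div_self hR.ne', one_smul]

/-- `F - id` is approximated by a C¹ map to within a positive lower bound of `‖F‖`. The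
approximation is forced to vanish outside radius `r + 1`; between `r` and `r + 1` zero is an
admissible value, so local constant choices exist. -/
theorem exists_zero_of_continuous_of_eq_self {r : ℝ} (hr : 0 < r) {F : E → E} (hF : Continuous F)
    (hid : ∀ x, r ≤ ‖x‖ → F x = x) : ∃ x, F x = 0 := by
  by_contra! h0
  obtain ⟨δ, hδ, hδF⟩ := (isCompact_closedBall (0 : E) (r + 1)).exists_forall_le'
    (f := fun x => ‖F x‖) hF.norm.continuousOn (a := 0) (fun x _ => norm_pos_iff.2 (h0 x))
  classical
  obtain ⟨k, hk, hkt⟩ := exists_contDiff_forall_mem_convex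
    (t := fun x : E => if ‖x‖ < r + 1 then ball (F x - x) δ else {0})
    (fun x => by split_ifs; exacts [convex_ball _ _, convex_singleton _]) (fun x => by
      have hc : Continuous fun x => F x - x := hF.sub continuous_id
      by_cases hx : ‖x‖ < r + 1
      · refine ⟨F x - x, ?_⟩
        filter_upwards [hc.continuousAt.preimage_mem_nhds (ball_mem_nhds (F x - x) hδ),
          continuous_norm.continuousAt.preimage_mem_nhds (Iio_mem_nhds hx)] with y hy hy'
        rw [if_pos (show ‖y‖ < r + 1 from hy')]
        exact mem_ball_comm.1 hy
      · refine ⟨0, ?_⟩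
        filter_upwards [continuous_norm.continuousAt.preimage_mem_nhds
          (Ioi_mem_nhds (show r < ‖x‖ by linarith))] with y hy
        rw [hid y (le_of_lt hy), sub_self]
        split_ifs
        exacts [mem_ball_self hδ, rfl])
  obtain ⟨x, hx⟩ := exists_zero_of_contDiff_of_eq_self (show 0 < r + 1 by linarith)
    (F := fun x => x + k x) (contDiff_id.add hk) (fun x hx => by
      have := hkt x
      rw [if_neg (by linarith)] at this
      rw [this, add_zero])
  have hkx := hkt x
  by_cases hxr : ‖x‖ < r + 1
  · rw [if_pos hxr, mem_ball_iff_norm, eq_neg_of_add_eq_zero_right hx] at hkx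
    have : -x - (F x - x) = - F x := by abel
    rw [this, norm_neg] at hkx
    exact absurd (hδF x (by simpa using hxr.le)) (by linarith)
  · rw [if_neg hxr] at hkx
    rw [hkx, add_zero] at hx
    rw [hx, norm_zero] at hxr
    linarith

/-- The displacement `F - id` is extended radially by `π` and cut off by `χ` at radius 2. It stays
bounded by `1/2`, so the zero found lies in the unit ball. -/
theorem exists_zero_of_near_identity {F : E → E} (hF : ContinuousOn F (closedBall 0 1))
    (hnear : ∀ x ∈ closedBall (0 : E) 1, ‖F x - x‖ ≤ 1 / 2) : ∃ x ∈ closedBall 0 1, F x = 0 := by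
  let π : E → E := fun x => (1 / max 1 ‖x‖) • x
  have hmax : ∀ x : E, 0 < max 1 ‖x‖ := fun x => lt_of_lt_of_le one_pos (le_max_left _ _)
  have hπ : Continuous π := by
    refine (continuous_const.div (continuous_const.max continuous_norm) fun x => (hmax x).ne').smul
      continuous_id
  have hπB : ∀ x, π x ∈ closedBall (0 : E) 1 := by
    intro x
    simp only [π, mem_closedBall_zero_iff, norm_smul]
    rw [Real.norm_of_nonneg (by positivity), one_div_mul_eq_div, div_le_one (hmax x)]
    exact le_max_right _ _
  have hπid : ∀ x ∈ closedBall (0 : E) 1, π x = x := by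
    intro x hx
    simp [π, max_eq_left (mem_closedBall_zero_iff.1 hx)]
  let χ : E → ℝ := fun x => max 0 (min 1 (2 - ‖x‖))
  have hχ : Continuous χ := by fun_prop
  have hχ0 : ∀ x, 0 ≤ χ x := fun x => le_max_left _ _
  have hχ1 : ∀ x, χ x ≤ 1 := fun x => max_le zero_le_one (min_le_left _ _)
  have hg : Continuous fun x => F (π x) - π x :=
    (hF.comp_continuous hπ hπB).sub hπ
  obtain ⟨x, hx⟩ := exists_zero_of_continuous_of_eq_self two_pos
    (F := fun x => x + χ x • (F (π x) - π x)) (continuous_id.add (hχ.smul hg)) (fun x hx => by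
      have : χ x = 0 := max_eq_left ((min_le_right _ _).trans (by linarith))
      simp [this])
  have hxB : x ∈ closedBall (0 : E) 1 := by
    by_contra hxB
    have h1 : 1 < ‖x‖ := by simpa using hxB
    have h2 : ‖x‖ = ‖χ x • (F (π x) - π x)‖ := by
      rw [eq_neg_of_add_eq_zero_right hx, norm_neg]
    rw [norm_smul, Real.norm_of_nonneg (hχ0 x)] at h2
    have h3 := hnear _ (hπB x)
    have h4 := mul_le_mul (hχ1 x) h3 (norm_nonneg _) zero_le_one
    linarith
  refine ⟨x, hxB, ?_⟩
  have h1 : χ x = 1 := by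
    have := mem_closedBall_zero_iff.1 hxB
    simp only [χ]
    rw [min_eq_left (by linarith), max_eq_right zero_le_one]
  simpa [h1, hπid x hxB] using hx

/-! ### Invariance of domain -/

/-- Let `G` extend the inverse of `f`. If `f 0` were not interior, the image could be pushed off a
small ball around a nearby missed point `c`, and a generic C¹ approximation of `G` would have no
zero on the pushed image. Yet composing with `f` gives a map near the identity, which has a zero. -/
theorem mem_interior_image_closedBall {f : E → E} (hf : ContinuousOn f (closedBall 0 1))
    (hinj : Set.InjOn f (closedBall 0 1)) : f 0 ∈ interior (f '' closedBall 0 1) := by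
  let _ : MeasurableSpace E := borel E
  have _ : BorelSpace E := ⟨rfl⟩
  have hB : IsCompact (closedBall (0 : E) 1) := isCompact_closedBall 0 1
  have hK : IsCompact (f '' closedBall 0 1) := hB.image_of_continuousOn hf
  have h0B : (0 : E) ∈ closedBall (0 : E) 1 := by simp
  -- extend the inverse
  obtain ⟨G, hG⟩ : ∃ G : C(E, E), ∀ x ∈ closedBall (0 : E) 1, G (f x) = x := by
    have : CompactSpace (closedBall (0 : E) 1) := isCompact_iff_compactSpace.1 hB
    have : TietzeExtension E := TietzeExtension.of_tvs ℝ
    have hemb : IsClosedEmbedding ((closedBall (0 : E) 1).domRestrict f) :=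
      (hf.domRestrict).isClosedEmbedding (Set.injOn_iff_injective.1 hinj)
    obtain ⟨G, hG⟩ := ContinuousMap.exists_extension' hemb (⟨Subtype.val, continuous_subtype_val⟩ :
      C(closedBall (0 : E) 1, E))
    exact ⟨G, fun x hx => congrFun hG ⟨x, hx⟩⟩
  have hG0 : G (f 0) = 0 := hG 0 h0B
  by_contra hint
  obtain ⟨ε, hε, hεG⟩ : ∃ ε > 0, ∀ y, ‖y - f 0‖ ≤ 2 * ε → ‖G y‖ ≤ 1 / 10 := by
    have := G.continuous.continuousAt.preimage_mem_nhds
      (ball_mem_nhds (G (f 0)) (show (0 : ℝ) < 1 / 10 by norm_num))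
    obtain ⟨e, he, hs⟩ := Metric.mem_nhds_iff.1 this
    refine ⟨e / 4, by positivity, fun y hy => ?_⟩
    have h := hs (show y ∈ ball (f 0) e by rw [mem_ball_iff_norm]; linarith)
    rw [Set.mem_preimage, hG0, mem_ball_zero_iff] at h
    exact h.le
  obtain ⟨c, hcK, hc⟩ : ∃ c, c ∉ f '' closedBall 0 1 ∧ ‖f 0 - c‖ < ε := by
    rw [mem_interior_iff_mem_nhds, Metric.mem_nhds_iff] at hint
    push Not at hint
    obtain ⟨c, hc, hc'⟩ := Set.not_subset.1 (hint ε hε)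
    exact ⟨c, hc', by rw [norm_sub_rev]; exact mem_ball_iff_norm.1 hc⟩
  obtain ⟨δ₀, hδ₀, hδG⟩ : ∃ δ₀ > 0, ∀ y ∈ f '' closedBall 0 1 ∩ {y | ε ≤ ‖y - c‖}, δ₀ ≤ ‖G y‖ := by
    refine (hK.inter_right (isClosed_le continuous_const (by fun_prop))).exists_forall_le'
      G.continuous.norm.continuousOn ?_
    rintro _ ⟨⟨x, hx, rfl⟩, hxc⟩
    rw [hG x hx, norm_pos_iff]
    rintro rfl
    exact absurd hxc (not_le.2 hc)
  let δ : ℝ := min (δ₀ / 4) (1 / 10)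
  have hδ : 0 < δ := by positivity
  have hδ1 : δ ≤ δ₀ / 4 := min_le_left _ _
  have hδ2 : δ ≤ 1 / 10 := min_le_right _ _
  obtain ⟨P, hP, hPG⟩ := exists_contDiff_dist_lt G.continuous hδ
  -- A C¹ map sends the null set `sphere c ε` to a null set, so a small translation makes it miss
  -- zero.
  obtain ⟨v, hv, hvP⟩ : ∃ v ∈ ball (0 : E) δ, v ∉ P '' sphere c ε := by
    have hnull : volume (P '' sphere c ε) = 0 :=
      addHaar_image_eq_zero_of_differentiableOn_of_addHaar_eq_zero volume
        (hP.differentiable one_ne_zero).differentiableOn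
        (Measure.addHaar_sphere_of_ne_zero volume c hε.ne')
    by_contra! h
    exact (measure_ball_pos volume (0 : E) hδ).ne' (measure_mono_null h hnull)
  rw [mem_ball_zero_iff] at hv
  have hPG' : ∀ y, ‖P y - v - G y‖ ≤ 2 * δ := by
    intro y
    have : P y - v - G y = (P y - G y) - v := by abel
    rw [this]
    have := norm_sub_le (P y - G y) v
    have := hPG y
    linarith
  -- Radial push from `c` onto the sphere, fixing everything outside the ball; it is continuous on
  -- the image of `f` since `c` is missed.
  let Φ : E → E := fun y => c + (max (ε / ‖y - c‖) 1) • (y - c)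
  have hΦ1 : ∀ y, ε ≤ ‖y - c‖ → Φ y = y := by
    intro y hy
    have : ε / ‖y - c‖ ≤ 1 := (div_le_one (by linarith)).2 hy
    simp [Φ, max_eq_right this]
  have hΦ2 : ∀ y ≠ c, ‖y - c‖ < ε → Φ y ∈ sphere c ε := by
    intro y hyc hy
    have hpos : 0 < ‖y - c‖ := norm_pos_iff.2 (sub_ne_zero.2 hyc)
    have : 1 ≤ ε / ‖y - c‖ := (one_le_div hpos).2 hy.le
    simp only [Φ, max_eq_left this, mem_sphere_iff_norm, add_sub_cancel_left, norm_smul]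
    rw [Real.norm_of_nonneg (by positivity), div_mul_cancel₀ _ hpos.ne']
  have hΦc : ContinuousOn Φ {c}ᶜ := by
    refine continuousOn_const.add (ContinuousOn.smul (ContinuousOn.sup
      (continuousOn_const.div (by fun_prop) fun y hy => ?_) continuousOn_const) (by fun_prop))
    exact norm_ne_zero_iff.2 (sub_ne_zero.2 hy)
  have hfc : ∀ x ∈ closedBall (0 : E) 1, f x ≠ c := fun x hx h => hcK ⟨x, hx, h⟩
  obtain ⟨x, hx, hx0⟩ := exists_zero_of_near_identity (F := fun x => P (Φ (f x)) - v)
    ((hP.continuous.comp_continuousOn (hΦc.comp hf hfc)).sub continuousOn_const) (fun x hx => by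
      by_cases h : ε ≤ ‖f x - c‖
      · rw [hΦ1 _ h]
        have := hPG' (f x)
        rw [hG x hx] at this
        linarith
      · rw [not_le] at h
        have hs := mem_sphere_iff_norm.1 (hΦ2 _ (hfc x hx) h)
        have h1 : ‖G (Φ (f x))‖ ≤ 1 / 10 := by
          refine hεG _ ?_
          have := norm_sub_le_norm_sub_add_norm_sub (Φ (f x)) c (f 0)
          rw [norm_sub_rev c] at this
          linarith
        have h2 : ‖G (f x)‖ ≤ 1 / 10 := by
          refine hεG _ ?_
          have := norm_sub_le_norm_sub_add_norm_sub (f x) c (f 0)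
          rw [norm_sub_rev c] at this
          linarith
        rw [hG x hx] at h2
        have h3 := hPG' (Φ (f x))
        have h4 : P (Φ (f x)) - v - x =
            (P (Φ (f x)) - v - G (Φ (f x))) + (G (Φ (f x)) - x) := by abel
        rw [h4]
        have h5 := norm_add_le (P (Φ (f x)) - v - G (Φ (f x))) (G (Φ (f x)) - x)
        have h6 := norm_sub_le (G (Φ (f x))) x
        linarith)
  by_cases h : ε ≤ ‖f x - c‖
  · rw [hΦ1 _ h] at hx0
    have h1 := hPG' (f x)
    rw [hx0, zero_sub, norm_neg] at h1
    have h2 := hδG _ ⟨⟨x, hx, rfl⟩, h⟩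
    linarith
  · exact hvP ⟨_, hΦ2 _ (hfc x hx) (not_le.1 h), sub_eq_zero.1 hx0⟩

theorem isOpen_image_of_injOn_of_innerProductSpace {f : E → E} {U : Set E} (hU : IsOpen U)
    (hf : ContinuousOn f U) (hinj : Set.InjOn f U) : IsOpen (f '' U) := by
  rw [isOpen_iff_mem_nhds]
  rintro _ ⟨x, hx, rfl⟩
  obtain ⟨r, hr, hrU⟩ := Metric.nhds_basis_closedBall.mem_iff.1 (hU.mem_nhds hx)
  have hmaps : Set.MapsTo (fun v : E => x + r • v) (closedBall 0 1) U := by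
    intro v hv
    refine hrU ?_
    rw [mem_closedBall_iff_norm, add_sub_cancel_left, norm_smul, Real.norm_of_nonneg hr.le]
    exact mul_le_of_le_one_right hr.le (mem_closedBall_zero_iff.1 hv)
  have h := mem_interior_image_closedBall (f := fun v => f (x + r • v))
    (hf.comp (by fun_prop) hmaps) (fun v hv v' hv' h => by
      have := add_left_cancel (hinj (hmaps hv) (hmaps hv') h)
      exact smul_right_injective E hr.ne' this)
  simp only [smul_zero, add_zero] at h
  refine Filter.mem_of_superset (mem_interior_iff_mem_nhds.1 h) ?_
  rintro _ ⟨v, hv, rfl⟩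
  exact ⟨_, hmaps hv, rfl⟩

/-- **Invariance of domain.** -/
theorem isOpen_image_of_injOn {V W : Type*} [NormedAddCommGroup V] [NormedSpace ℝ V]
    [FiniteDimensional ℝ V] [NormedAddCommGroup W] [NormedSpace ℝ W] [FiniteDimensional ℝ W]
    (hVW : Module.finrank ℝ V = Module.finrank ℝ W) {f : V → W} {U : Set V} (hU : IsOpen U)
    (hf : ContinuousOn f U) (hinj : Set.InjOn f U) : IsOpen (f '' U) := by
  let e : V ≃L[ℝ] EuclideanSpace ℝ (Fin (Module.finrank ℝ V)) :=
    ContinuousLinearEquiv.ofFinrankEq (by simp)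
  let e' : W ≃L[ℝ] EuclideanSpace ℝ (Fin (Module.finrank ℝ V)) :=
    ContinuousLinearEquiv.ofFinrankEq (by simp [hVW])
  have hm : Set.MapsTo e.symm (e '' U) U := by
    rintro _ ⟨x, hx, rfl⟩
    simpa using hx
  have h := isOpen_image_of_injOn_of_innerProductSpace (f := fun y => e' (f (e.symm y)))
    (U := e '' U) (e.toHomeomorph.isOpenMap _ hU)
    (e'.continuous.comp_continuousOn (hf.comp e.symm.continuous.continuousOn hm))
    (fun x hx y hy hxy => e.symm.injective (hinj (hm hx) (hm hy) (e'.injective hxy)))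
  have h2 := h.preimage e'.continuous
  convert h2 using 1
  ext y
  simp

end InvarianceOfDomain

end DiscreteFlow

namespace DiscreteFlow

open Topology

/-! ### Faces of cells in finite regular complexes. -/

section RegularComplexes

open Metric Set

/-! ### Invariance of domain on spheres -/

/-- Coning off, `x ↦ (φ (x/‖x‖), ‖x‖)` is injective between spaces of equal dimension. Its image is
open, and the slice at height 1 is the set in question. -/
theorem isOpen_image_inter_sphere {n : ℕ} {O : Set (Fin (n + 1) → ℝ)} (hO : IsOpen O)
    {φ : (Fin (n + 1) → ℝ) → Fin n → ℝ} (hφ : ContinuousOn φ (O ∩ sphere 0 1))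
    (hinj : InjOn φ (O ∩ sphere 0 1)) : IsOpen (φ '' (O ∩ sphere 0 1)) := by
  let ν : (Fin (n + 1) → ℝ) → Fin (n + 1) → ℝ := fun x => ‖x‖⁻¹ • x
  have hν : ContinuousOn ν {0}ᶜ :=
    (continuousOn_id.norm.inv₀ fun x hx => norm_ne_zero_iff.2 hx).smul continuousOn_id
  let U : Set (Fin (n + 1) → ℝ) := {0}ᶜ ∩ ν ⁻¹' O
  have hU : IsOpen U := hν.isOpen_inter_preimage isOpen_compl_singleton hO
  have hmaps : MapsTo ν U (O ∩ sphere 0 1) := fun x hx => ⟨hx.2, by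
    rw [mem_sphere_zero_iff_norm, norm_smul, norm_inv, norm_norm,
      inv_mul_cancel₀ (norm_ne_zero_iff.2 hx.1)]⟩
  have h := isOpen_image_of_injOn (W := (Fin n → ℝ) × ℝ) (by simp) (f := fun x => (φ (ν x), ‖x‖)) hU
    ((hφ.comp (hν.mono inter_subset_left) hmaps).prodMk continuous_norm.continuousOn) (by
      intro x hx y hy hxy
      have h1 := hinj (hmaps hx) (hmaps hy) (congrArg Prod.fst hxy)
      have h2 : ‖x‖ = ‖y‖ := congrArg Prod.snd hxy
      simp only [ν, h2] at h1
      exact smul_right_injective _ (inv_ne_zero (norm_ne_zero_iff.2 hy.1)) h1)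
  convert h.preimage (f := fun y => (y, (1 : ℝ))) (by fun_prop) using 1
  ext y
  simp only [mem_image, mem_preimage, Prod.mk.injEq]
  constructor
  · rintro ⟨x, hx, rfl⟩
    have hx1 : ‖x‖ = 1 := mem_sphere_zero_iff_norm.1 hx.2
    have hνx : ν x = x := by simp [ν, hx1]
    refine ⟨x, ⟨fun h0 => ?_, by rw [mem_preimage, hνx]; exact hx.1⟩, by rw [hνx], hx1⟩
    rw [mem_singleton_iff.1 h0, norm_zero] at hx1
    exact zero_ne_one hx1
  · rintro ⟨x, hx, rfl, -⟩
    exact ⟨_, hmaps hx, rfl⟩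

/-- Padding with zeros puts an open image inside a hyperplane, which has empty interior. -/
theorem inter_sphere_eq_empty_of_injOn {n k : ℕ} (hk : k < n) {O : Set (Fin (n + 1) → ℝ)}
    (hO : IsOpen O) {φ : (Fin (n + 1) → ℝ) → Fin k → ℝ} (hφ : ContinuousOn φ (O ∩ sphere 0 1))
    (hinj : InjOn φ (O ∩ sphere 0 1)) : O ∩ sphere 0 1 = ∅ := by
  by_contra hne
  let ι : (Fin k → ℝ) → Fin n → ℝ := fun v i => if h : i.1 < k then v ⟨i, h⟩ else 0
  have hι : Continuous ι := by
    refine continuous_pi fun i => ?_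
    by_cases h : i.1 < k
    · simpa only [ι, dif_pos h] using continuous_apply _
    · simpa only [ι, dif_neg h] using continuous_const
  have hιinj : Function.Injective ι := fun v v' h => by
    ext j
    simpa [ι] using congrFun h ⟨j, j.2.trans hk⟩
  have hopen := isOpen_image_inter_sphere hO (hι.comp_continuousOn hφ) (hιinj.comp_injOn hinj)
  have hsub : (ι ∘ φ) '' (O ∩ sphere 0 1) ⊆
      (LinearMap.ker (LinearMap.proj ⟨k, hk⟩ : (Fin n → ℝ) →ₗ[ℝ] ℝ) : Set (Fin n → ℝ)) := by
    rintro _ ⟨x, -, rfl⟩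
    simp [ι]
  have htop := Submodule.eq_top_of_nonempty_interior' _
    (((nonempty_iff_ne_empty.2 hne).image _).mono (interior_maximal hsub hopen))
  have : Pi.single ⟨k, hk⟩ (1 : ℝ) ∈ LinearMap.ker (LinearMap.proj ⟨k, hk⟩ : (Fin n → ℝ) →ₗ[ℝ] ℝ) :=
    htop ▸ Submodule.mem_top
  simp at this

/-! ### Boundaries of cells in regular complexes -/

variable {X : Type*} [TopologicalSpace X] {C : Set X} [CWComplex C]

/-- By regularity, a piece of the frontier lying in one open cell becomes an open piece of a sphere
injecting into Euclidean space, to which the two preceding lemmas apply. -/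
theorem exists_isOpen_forall_injOn_cellFrontier (hreg : IsRegularCW C) {n : ℕ}
    (i : RelCWComplex.cell C n) (e : Cell C) {V : Set X} (hV : IsOpen V)
    (hVe : RelCWComplex.cellFrontier n i ∩ V ⊆ RelCWComplex.openCell e.1 e.2) :
    ∃ (O : Set (Fin n → ℝ)) (φ : (Fin n → ℝ) → Fin e.1 → ℝ), IsOpen O ∧
      ContinuousOn φ (O ∩ sphere 0 1) ∧ InjOn φ (O ∩ sphere 0 1) ∧
      φ '' (O ∩ sphere 0 1) =
        (RelCWComplex.map e.1 e.2).symm '' (RelCWComplex.cellFrontier n i ∩ V) := by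
  have hc : ContinuousOn (RelCWComplex.map n i) (sphere 0 1) :=
    (RelCWComplex.continuousOn n i).mono sphere_subset_closedBall
  have hinj : InjOn (RelCWComplex.map n i) (sphere 0 1) :=
    injOn_iff_injective.2 (hreg n i).injective
  obtain ⟨O, hO, hOV⟩ := continuousOn_iff'.1 hc V hV
  have himg : RelCWComplex.map n i '' (O ∩ sphere 0 1) = RelCWComplex.cellFrontier n i ∩ V := by
    rw [← hOV, inter_comm, image_inter_preimage]
    rfl
  have htarget : RelCWComplex.openCell e.1 e.2 = (RelCWComplex.map e.1 e.2).target := by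
    rw [← (RelCWComplex.map e.1 e.2).image_source_eq_target, RelCWComplex.source_eq]
    rfl
  have hmaps : MapsTo (RelCWComplex.map n i) (O ∩ sphere 0 1)
      (RelCWComplex.map e.1 e.2).target := by
    rw [mapsTo_iff_image_subset, himg, ← htarget]
    exact hVe
  refine ⟨O, (RelCWComplex.map e.1 e.2).symm ∘ RelCWComplex.map n i, hO,
    (RelCWComplex.continuousOn_symm _ _).comp (hc.mono inter_subset_right) hmaps,
    (RelCWComplex.map e.1 e.2).symm.injOn.comp (hinj.mono inter_subset_right) hmaps, ?_⟩
  rw [image_comp, himg]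

/-- The complement of the closed cells other than `e` of dimension at most `dim e`. -/
def Cell.nhd (e : Cell C) : Set X := (⋃ c ∈ {c : Cell C | c ≠ e ∧ c.dim ≤ e.dim}, c.carrier)ᶜ

theorem Cell.isOpen_nhd [T2Space X] [RelCWComplex.Finite C] (e : Cell C) : IsOpen e.nhd := by
  have : Finite (Cell C) := RelCWComplex.finite_cells_of_finite
  exact ((toFinite _).isClosed_biUnion fun c _ => RelCWComplex.isClosed_closedCell).isOpen_compl

theorem Cell.openCell_subset_nhd (e : Cell C) : RelCWComplex.openCell e.1 e.2 ⊆ e.nhd := by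
  intro p hp hp'
  simp only [mem_iUnion, mem_ofPred_eq] at hp'
  obtain ⟨c, ⟨hce, hdim⟩, hpc⟩ := hp'
  rcases Cell.eq_or_dim_lt_of_openCell_inter ⟨p, hp, hpc⟩ with rfl | h
  · exact hce rfl
  · omega

theorem Cell.mem_openCell_of_mem_nhd {e c : Cell C} (hdim : c.dim ≤ e.dim) {p : X}
    (hp : p ∈ e.nhd) (hpc : p ∈ RelCWComplex.openCell c.1 c.2) : c = e := by
  by_contra hce
  exact hp (mem_biUnion (show c ∈ {c : Cell C | c ≠ e ∧ c.dim ≤ e.dim} from ⟨hce, hdim⟩)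
    (RelCWComplex.openCell_subset_closedCell _ _ hpc))

/-- The part of the open cell `e` in the frontier of `x` is closed in `e`, and open by invariance of
domain; the ball is connected. -/
theorem Cell.carrier_subset_cellFrontier_of_dim_succ [T2Space X] [RelCWComplex.Finite C]
    (hreg : IsRegularCW C) {x e : Cell C} (hdim : e.dim + 1 = x.dim)
    (h : (RelCWComplex.openCell e.1 e.2 ∩ RelCWComplex.cellFrontier x.1 x.2).Nonempty) :
    e.carrier ⊆ RelCWComplex.cellFrontier x.1 x.2 := by
  obtain ⟨m, i⟩ := x
  obtain ⟨n, j⟩ := e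
  obtain rfl : n + 1 = m := hdim
  set e : Cell C := ⟨n, j⟩
  change e.carrier ⊆ RelCWComplex.cellFrontier (n + 1) i
  change (RelCWComplex.openCell n j ∩ RelCWComplex.cellFrontier (n + 1) i).Nonempty at h
  have hSV : RelCWComplex.cellFrontier (n + 1) i ∩ e.nhd ⊆ RelCWComplex.openCell n j := by
    rintro p ⟨hp, hpe⟩
    obtain ⟨c, hc, hpc⟩ := Cell.exists_mem_openCell_of_mem_cellFrontier (x := ⟨n + 1, i⟩) hp
    have := Cell.mem_openCell_of_mem_nhd (Nat.le_of_lt_succ hc) hpe hpc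
    subst this
    exact hpc
  obtain ⟨O, φ, hO, hφ, hinj, himg⟩ :=
    exists_isOpen_forall_injOn_cellFrontier hreg i e e.isOpen_nhd hSV
  have hopen := isOpen_image_inter_sphere hO hφ hinj
  rw [himg] at hopen
  have hmap := RelCWComplex.continuousOn n j
  have hsource := RelCWComplex.source_eq n j
  have hS : IsClosed (RelCWComplex.cellFrontier (n + 1) i) := RelCWComplex.isClosed_cellFrontier
  have hV' : IsOpen (ball 0 1 ∩ RelCWComplex.map n j ⁻¹' (RelCWComplex.cellFrontier (n + 1) i)ᶜ) :=
    (hmap.mono ball_subset_closedBall).isOpen_inter_preimage isOpen_ball hS.isOpen_compl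
  have hleft : ∀ v ∈ ball (0 : Fin n → ℝ) 1,
      (RelCWComplex.map n j).symm (RelCWComplex.map n j v) = v := fun v hv =>
    (RelCWComplex.map n j).left_inv (hsource ▸ hv)
  have hsub := (convex_ball (0 : Fin n → ℝ) 1).isPreconnected.subset_left_of_subset_union hopen hV'
    (by
      rw [disjoint_left]
      rintro _ ⟨p, hp, rfl⟩ ⟨-, hp'⟩
      obtain ⟨v, hv, rfl⟩ := hSV hp
      change RelCWComplex.map n j ((RelCWComplex.map n j).symm (RelCWComplex.map n j v)) ∉ _ at hp'
      rw [hleft v hv] at hp'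
      exact hp' hp.1)
    (by
      intro v hv
      by_cases hvS : RelCWComplex.map n j v ∈ RelCWComplex.cellFrontier (n + 1) i
      · exact .inl ⟨_, ⟨hvS, e.openCell_subset_nhd ⟨v, hv, rfl⟩⟩, hleft v hv⟩
      · exact .inr ⟨hv, hvS⟩)
    (by
      obtain ⟨_, ⟨v, hv, rfl⟩, hvS⟩ := h
      exact ⟨v, hv, _, ⟨hvS, e.openCell_subset_nhd ⟨v, hv, rfl⟩⟩, hleft v hv⟩)
  have hopenCell : RelCWComplex.openCell n j ⊆ RelCWComplex.cellFrontier (n + 1) i := by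
    rintro _ ⟨v, hv, rfl⟩
    obtain ⟨p, hp, hpv⟩ := hsub hv
    obtain ⟨v', hv', rfl⟩ := hSV hp
    change (RelCWComplex.map n j).symm (RelCWComplex.map n j v') = v at hpv
    rw [hleft v' hv'] at hpv
    exact hpv ▸ hp.1
  change RelCWComplex.closedCell n j ⊆ _
  rw [← RelCWComplex.closure_openCell_eq_closedCell]
  exact hS.closure_subset_iff.2 hopenCell

/-- The points of the frontier on no facet form an open piece of the sphere. If it is nonempty, a
cell of maximal dimension meeting it contains an open piece, although its dimension is too small. -/
theorem Cell.exists_facet_of_mem_cellFrontier [T2Space X] [RelCWComplex.Finite C]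
    (hreg : IsRegularCW C) {x : Cell C} {p : X} (hp : p ∈ RelCWComplex.cellFrontier x.1 x.2) :
    ∃ e : Cell C, e.dim + 1 = x.dim ∧ p ∈ e.carrier ∧
      e.carrier ⊆ RelCWComplex.cellFrontier x.1 x.2 := by
  have : Finite (Cell C) := RelCWComplex.finite_cells_of_finite
  obtain ⟨m, i⟩ := x
  obtain _ | n := m
  · obtain ⟨e, he, -⟩ := Cell.exists_mem_openCell_of_mem_cellFrontier hp
    exact (Nat.not_lt_zero _ he).elim
  change p ∈ RelCWComplex.cellFrontier (n + 1) i at hp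
  by_contra! hno
  let V : Set X := (⋃ e ∈ {e : Cell C | e.dim = n ∧
    e.carrier ⊆ RelCWComplex.cellFrontier (n + 1) i}, e.carrier)ᶜ
  have hV : IsOpen V :=
    ((toFinite _).isClosed_biUnion fun c _ => RelCWComplex.isClosed_closedCell).isOpen_compl
  have hpV : p ∈ V := by
    intro hp'
    simp only [mem_iUnion, mem_ofPred_eq] at hp'
    obtain ⟨e, ⟨he, hes⟩, hpe⟩ := hp'
    exact hno e (congrArg (· + 1) he) hpe hes
  let A : Set (Cell C) := {c | (RelCWComplex.openCell c.1 c.2 ∩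
    (RelCWComplex.cellFrontier (n + 1) i ∩ V)).Nonempty}
  have hmem : ∀ q ∈ RelCWComplex.cellFrontier (n + 1) i ∩ V, ∃ c ∈ A,
      q ∈ RelCWComplex.openCell c.1 c.2 := by
    intro q hq
    obtain ⟨c, -, hqc⟩ := Cell.exists_mem_openCell_of_mem_cellFrontier (x := ⟨n + 1, i⟩) hq.1
    exact ⟨c, ⟨q, hqc, hq⟩, hqc⟩
  have hdim : ∀ c ∈ A, c.dim < n := by
    rintro c ⟨q, hqc, hqS, hqV⟩
    obtain ⟨c', hc', hqc'⟩ := Cell.exists_mem_openCell_of_mem_cellFrontier (x := ⟨n + 1, i⟩) hqS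
    obtain rfl : c = c' := by
      by_contra hne
      exact disjoint_left.1 (Cell.disjoint_openCell hne) hqc hqc'
    refine lt_of_le_of_ne (Nat.le_of_lt_succ hc') fun hcn => hqV ?_
    exact mem_biUnion (show c ∈ {e : Cell C | e.dim = n ∧
      e.carrier ⊆ RelCWComplex.cellFrontier (n + 1) i} from ⟨hcn,
        Cell.carrier_subset_cellFrontier_of_dim_succ hreg (x := ⟨n + 1, i⟩)
          (congrArg (· + 1) hcn) ⟨q, hqc, hqS⟩⟩) (RelCWComplex.openCell_subset_closedCell _ _ hqc)
  obtain ⟨e, heA, hemax⟩ := (toFinite A).exists_maximalFor Cell.dim A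
    (let ⟨c, hc, _⟩ := hmem p ⟨hp, hpV⟩; ⟨c, hc⟩)
  have hSV : RelCWComplex.cellFrontier (n + 1) i ∩ (V ∩ e.nhd) ⊆ RelCWComplex.openCell e.1 e.2 := by
    rintro q ⟨hqS, hqV, hqe⟩
    obtain ⟨c, hcA, hqc⟩ := hmem q ⟨hqS, hqV⟩
    have hce : c.dim ≤ e.dim := (le_total c.dim e.dim).elim id fun h => hemax hcA h
    obtain rfl := Cell.mem_openCell_of_mem_nhd hce hqe hqc
    exact hqc
  obtain ⟨O, φ, hO, hφ, hinj, himg⟩ :=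
    exists_isOpen_forall_injOn_cellFrontier hreg i e (hV.inter e.isOpen_nhd) hSV
  rw [inter_sphere_eq_empty_of_injOn (hdim e heA) hO hφ hinj, image_empty, eq_comm,
    image_eq_empty] at himg
  obtain ⟨q, hqe, hqS, hqV⟩ := heA
  exact himg.subset ⟨hqS, hqV, e.openCell_subset_nhd hqe⟩

theorem Cell.mem_cellFrontier_of_ne {x y : Cell C} (h : y ≠ x) {p : X}
    (hp : p ∈ RelCWComplex.openCell y.1 y.2) (hpx : p ∈ x.carrier) :
    p ∈ RelCWComplex.cellFrontier x.1 x.2 := by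
  rw [Cell.carrier, ← RelCWComplex.cellFrontier_union_openCell_eq_closedCell] at hpx
  exact hpx.resolve_right fun h' => disjoint_left.1 (Cell.disjoint_openCell h) hp h'

/-- Induction on `dim x`: a common point lies on a facet `e` of `x`, and either `y = e` or `y` meets
the frontier of `e`. -/
theorem Cell.carrier_subset_cellFrontier [T2Space X] [RelCWComplex.Finite C]
    (hreg : IsRegularCW C) {x y : Cell C}
    (h : (RelCWComplex.openCell y.1 y.2 ∩ RelCWComplex.cellFrontier x.1 x.2).Nonempty) :
    y.carrier ⊆ RelCWComplex.cellFrontier x.1 x.2 := by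
  induction hn : x.dim generalizing x with
  | zero =>
    obtain ⟨p, -, hp⟩ := h
    obtain ⟨e, he, -⟩ := Cell.exists_mem_openCell_of_mem_cellFrontier hp
    omega
  | succ n ih =>
    obtain ⟨p, hpy, hp⟩ := h
    obtain ⟨e, he, hpe, hes⟩ := Cell.exists_facet_of_mem_cellFrontier hreg hp
    by_cases hye : y = e
    · exact hye ▸ hes
    · exact (ih ⟨p, hpy, Cell.mem_cellFrontier_of_ne hye hpy hpe⟩ (by omega)).trans
        ((RelCWComplex.cellFrontier_subset_closedCell _ _).trans hes)

theorem Cell.above_of_subset {x y : Cell C} (h : y.carrier ⊆ x.carrier) (hdim : y.dim < x.dim) :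
    x.Above y := by
  refine ⟨h, fun h' => ?_⟩
  obtain ⟨p, hp⟩ := RelCWComplex.openCell_nonempty x.1 x.2
  rcases Cell.eq_or_dim_lt_of_openCell_inter
    ⟨p, hp, h' (RelCWComplex.openCell_subset_closedCell _ _ hp)⟩ with rfl | h''
  · exact lt_irrefl _ hdim
  · omega

/-- In a regular complex there is a cell strictly between two nested cells whose dimensions differ
by at least two. -/
theorem Cell.Above.exists_between [T2Space X] [RelCWComplex.Finite C] (hreg : IsRegularCW C)
    {x y : Cell C} (h : x.Above y) (hdim : y.dim + 2 ≤ x.dim) :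
    ∃ c : Cell C, x.Above c ∧ c.Above y := by
  obtain ⟨p, hp⟩ := RelCWComplex.openCell_nonempty y.1 y.2
  have hpx := h.subset (RelCWComplex.openCell_subset_closedCell _ _ hp)
  obtain ⟨e, he, hpe, hes⟩ := Cell.exists_facet_of_mem_cellFrontier hreg
    (Cell.mem_cellFrontier_of_ne (by rintro rfl; omega) hp hpx)
  have hye : y ≠ e := by rintro rfl; omega
  refine ⟨e, Cell.above_of_subset (hes.trans (RelCWComplex.cellFrontier_subset_closedCell _ _))
    (by omega), Cell.above_of_subset ?_ (by omega)⟩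
  exact (Cell.carrier_subset_cellFrontier hreg
    ⟨p, hp, Cell.mem_cellFrontier_of_ne hye hp hpe⟩).trans
      (RelCWComplex.cellFrontier_subset_closedCell _ _)

end RegularComplexes

end DiscreteFlow

theorem mainTheorem5 {X : Type*} [TopologicalSpace X] [T2Space X] (C : Set X)
    [Topology.CWComplex C] [Topology.RelCWComplex.Finite C] (hreg : DiscreteFlow.IsRegularCW C)
    (f : DiscreteFlow.Cell C → ℝ) (hf : DiscreteFlow.IsDiscreteMorse f)
    (w z : DiscreteFlow.Cell C)
    (hw : DiscreteFlow.IsCritical f w) (hz : DiscreteFlow.IsCritical f z) :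
    (∀ τ τ' : DiscreteFlow.Zigzag f z w,
      DiscreteFlow.FlowHom.mk τ = DiscreteFlow.FlowHom.mk τ' → τ.rank = τ'.rank) ∧
    ∃ po : PartialOrder (DiscreteFlow.FlowHom f w z),
      (∀ γ γ' : DiscreteFlow.FlowHom f w z, γ ≤ γ' ↔ γ.Implies γ') ∧
      ∃ ρ : WithBot (DiscreteFlow.FlowHom f w z)ᵒᵈ → ℤ,
        ρ ⊥ = -1 ∧
        (∀ τ : DiscreteFlow.Zigzag f z w,
          ρ (WithBot.some (OrderDual.toDual (DiscreteFlow.FlowHom.mk τ))) = τ.rank) ∧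
        DiscreteFlow.IsRankFunction ρ :=
  ⟨fun _ _ h => DiscreteFlow.Zigzag.rank_eq_of_equiv (DiscreteFlow.FlowHom.mk_eq_mk.1 h),
    DiscreteFlow.FlowHom.partialOrder f w z, fun _ _ => Iff.rfl,
    DiscreteFlow.FlowHom.extendedRank, rfl, fun _ => rfl,
    DiscreteFlow.FlowHom.isRankFunction_extendedRank
      fun _ _ h => h.exists_between hreg⟩
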